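/- Let $1\le r\le n$ be integers, $f\in C^{4n}(\mathbb R^n\times\mathbb R^r;\mathbb R^n)$ with $f(0,0)=0$, put $A=\frac{\partial f}{\partial x}(0,0)$, $B=\frac{\partial f}{\partial u}(0,0)$, and assume $\operatorname{rank}(B,AB,\dots,A^{n-1}B)=n$. Let $N>0$. For $\bar x,F\in\mathbb R^n$ consider the boundary value problem $$\dot x=f(x,u)+F,\quad t\in[0,1],\qquad x(0)=0,\quad x(1)=\bar x,\qquad \|u(t)\|<N, \tag{1}$$ with $x,u$ continuous on $[0,1]$ and $F$ constant. Notation. Put $g(x,u)=f(x,u)+F$. Let $\sigma_0=0$ and, for $k=1,\dots,4n-1$, let $\sigma_k(s)=\sigma_{k-1}(s)+s^k\varphi^{(k)}$, where $$\varphi^{(k)}=-\frac1k\cdot\frac1{(k-1)!}\,\frac{d^{k-1}}{ds^{k-1}}\Big|_{s=0}g(\bar x+\sigma_{k-1}(s),0),$$ and let $\sigma=\sigma_{4n-1}$. For $\alpha>0$ put $$P(\tau)=\alpha\sum_{i=1}^{n}e^{-i\alpha\tau}P_i,\qquad Q(\tau)=\alpha\sum_{i=1}^{2n}e^{-i\alpha\tau}Q_i,$$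 where $P_i$ and $Q_i$ are the Taylor coefficients of order $i-1$ at $s=0$ of $\frac{\partial g}{\partial x}(\bar x+\sigma(s),0)$ and $\frac{\partial g}{\partial u}(\bar x+\sigma(s),0)$ respectively. Then there exist $\varepsilon>0$ and $\alpha>0$ such that for all $\bar x,F\in\mathbb R^n$ with $\|\bar x\|<\varepsilon$ and $\|F\|<\varepsilon$ the problem (1) has a solution $(x,u)$, and one is obtained as follows: (i) (stabilization) there is a continuous $M:[0,\infty)\to\mathbb R^{r\times n}$ such that the feedback $d=M(\tau)c$ stabilizes the linear non-stationary system $\frac{dc}{d\tau}=P(\tau)c+Q(\tau)d$, i.e. the fundamental matrix $\Phi$ $(\Phi(0)=I)$ of $\frac{dc}{d\tau}=(P+QM)c$ satisfies $\|\Phi(\tau)\|\le Ke^{-\lambda\tau}$ for $\tau\ge0$, with some $K,\lambda>0$; (ii) (initial value problem) with this $M$ the auxiliary initial value problem $$\frac{dy}{d\tau}=\alpha e^{-\alpha\tau}g\big(\bar x+y+\sigma(e^{-\alpha\tau}),M(\tau)y\big)-\frac{d}{d\tau}\sigma(e^{-\alpha\tau}),\qquad y(0)=-\bar x-\sigma(1),$$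 has a unique solution $y$ on $[0,\infty)$; (iii) with $\tau(t)=-\frac1\alpha\ln(1-t)$, the functions $$x(t)=\bar x+y(\tau(t))+\sigma(1-t),\qquad u(t)=M(\tau(t))\,y(\tau(t)),\qquad 0\le t<1,$$ extend continuously to $t=1$, and the extended pair $(x,u)$ is a solution of (1). -/

import Mathlib

open Set

noncomputable section

namespace SynthControl

/-- `ℝⁿ` with the Euclidean norm. -/
abbrev Vec (n : ℕ) : Type := EuclideanSpace ℝ (Fin n)

/-- The matrix `A = ∂f/∂x (0,0)`. -/
def jacX {n r : ℕ} (f : Vec n × Vec r → Vec n) : Matrix (Fin n) (Fin n) ℝ :=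
  Matrix.of fun i j => fderiv ℝ (fun x : Vec n => f (x, 0)) 0 (EuclideanSpace.single j 1) i

/-- The matrix `B = ∂f/∂u (0,0)`. -/
def jacU {n r : ℕ} (f : Vec n × Vec r → Vec n) : Matrix (Fin n) (Fin r) ℝ :=
  Matrix.of fun i j => fderiv ℝ (fun u : Vec r => f (0, u)) 0 (EuclideanSpace.single j 1) i

/-- The matrix `S = (B, AB, A²B, …, Aⁿ⁻¹B)`; its columns are indexed by the pairs `(k, j)`
(column `j` of `Aᵏ B`). -/
def controllabilityMatrix {n r : ℕ} (A : Matrix (Fin n) (Fin n) ℝ)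
    (B : Matrix (Fin n) (Fin r) ℝ) : Matrix (Fin n) (Fin n × Fin r) ℝ :=
  Matrix.of fun i p => (A ^ (p.1 : ℕ) * B) i p.2

/-- The system `ẋ = f(x,u) + F` has the right-hand side `perturbed f F`. -/
def perturbed {n r : ℕ} (f : Vec n × Vec r → Vec n) (F : Vec n) : Vec n × Vec r → Vec n :=
  fun p => f p + F

/-- `(x, u)` solves the boundary value problem `ẋ = g(x,u)` on `[0,1]`, `x(0) = 0`, `x(1) = x̄`,
with `x` and `u` continuous on `[0,1]` and the control restriction `‖u‖ < N`.
(Derivatives are one-sided at the end points.) -/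
structure IsBVPSolution {n r : ℕ} (g : Vec n × Vec r → Vec n) (N : ℝ) (xbar : Vec n)
    (x : ℝ → Vec n) (u : ℝ → Vec r) : Prop where
  continuousOn_x : ContinuousOn x (Icc 0 1)
  continuousOn_u : ContinuousOn u (Icc 0 1)
  ode : ∀ t ∈ Icc (0 : ℝ) 1, HasDerivWithinAt x (g (x t, u t)) (Icc 0 1) t
  control_lt : ∀ t ∈ Icc (0 : ℝ) 1, ‖u t‖ < N
  initial : x 0 = 0
  final : x 1 = xbar

/-- The sum of the first `k` shifts, as a polynomial in `s = e^{-ατ}`: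
`shift g x̄ k s = ∑_{j=1}^{k} sʲ φ⁽ʲ⁾(x̄)`.
After the substitution `c = c⁽ᵏ⁾ + shift g x̄ k (e^{-ατ})` in
`dc/dτ = α e^{-ατ} g(x̄ + c, d)`, the coefficient of `e^{-(k+1)ατ}` in the terms free of `c⁽ᵏ⁾` and `d`
is `α` times the Taylor coefficient of order `k` at `s = 0` of `g(x̄ + shift g x̄ k s, 0)`; the next
shift `φ⁽ᵏ⁺¹⁾` is the one which cancels this term. -/
def shift {n r : ℕ} (g : Vec n × Vec r → Vec n) (xbar : Vec n) : ℕ → ℝ → Vec n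
  | 0 => fun _ => 0
  | k + 1 => fun s => shift g xbar k s + s ^ (k + 1) •
      (-((1 : ℝ) / (k + 1)) • (((1 : ℝ) / (k.factorial : ℝ)) •
        iteratedDeriv k (fun σ : ℝ => g (xbar + shift g xbar k σ, 0)) 0))

/-- The total shift after all `4n - 1` stages. -/
def totalShift {n r : ℕ} (g : Vec n × Vec r → Vec n) (xbar : Vec n) : ℝ → Vec n :=
  shift g xbar (4 * n - 1)

/-- `P_{i+1}(x̄)`: the Taylor coefficient of order `i` at `s = 0` of
`∂g/∂x (x̄ + totalShift s, 0)`. In particular `P₁(x̄) = ∂g/∂x (x̄, 0)`. -/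
def coeffP {n r : ℕ} (g : Vec n × Vec r → Vec n) (xbar : Vec n) (i : ℕ) : Vec n →L[ℝ] Vec n :=
  ((1 : ℝ) / (i.factorial : ℝ)) • iteratedDeriv i
    (fun s : ℝ => fderiv ℝ (fun x : Vec n => g (x, 0)) (xbar + totalShift g xbar s)) 0

/-- `Q_{i+1}(x̄)`: the Taylor coefficient of order `i` at `s = 0` of
`∂g/∂u (x̄ + totalShift s, 0)`. In particular `Q₁(x̄) = ∂g/∂u (x̄, 0)`. -/
def coeffQ {n r : ℕ} (g : Vec n × Vec r → Vec n) (xbar : Vec n) (i : ℕ) : Vec r →L[ℝ] Vec n :=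
  ((1 : ℝ) / (i.factorial : ℝ)) • iteratedDeriv i
    (fun s : ℝ => fderiv ℝ (fun u : Vec r => g (xbar + totalShift g xbar s, u)) 0) 0

/-- `P(τ) = α (e^{-ατ} P₁ + e^{-2ατ} P₂ + ⋯ + e^{-nατ} P_n)`: the terms of the shifted system that
are linear in the phase variable, with the coefficients `e^{-iατ}`, `i = 1, …, n`. -/
def linP {n r : ℕ} (g : Vec n × Vec r → Vec n) (α : ℝ) (xbar : Vec n) (τ : ℝ) :
    Vec n →L[ℝ] Vec n :=
  ∑ i ∈ Finset.range n, (α * Real.exp (-(((i : ℝ) + 1) * α * τ))) • coeffP g xbar i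

/-- `Q(τ) = α (e^{-ατ} Q₁ + e^{-2ατ} Q₂ + ⋯ + e^{-2nατ} Q_{2n})`: the terms of the shifted system
that are linear in the control, with the coefficients `e^{-iατ}`, `i = 1, …, 2n`. -/
def linQ {n r : ℕ} (g : Vec n × Vec r → Vec n) (α : ℝ) (xbar : Vec n) (τ : ℝ) :
    Vec r →L[ℝ] Vec n :=
  ∑ i ∈ Finset.range (2 * n), (α * Real.exp (-(((i : ℝ) + 1) * α * τ))) • coeffQ g xbar i

/-- The feedback `d = M(τ) c` stabilizes the linear system `dc/dτ = P(τ) c + Q(τ) d` on `[0,∞)`: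
the fundamental matrix `Φ`, `Φ(0) = I`, of the closed system `dc/dτ = (P(τ) + Q(τ) M(τ)) c`
decreases exponentially. -/
def IsStabilizing {n r : ℕ} (P : ℝ → Vec n →L[ℝ] Vec n) (Q : ℝ → Vec r →L[ℝ] Vec n)
    (M : ℝ → Vec n →L[ℝ] Vec r) : Prop :=
  ContinuousOn M (Ici 0) ∧
  ∃ Φ : ℝ → Vec n →L[ℝ] Vec n,
    Φ 0 = ContinuousLinearMap.id ℝ (Vec n) ∧
    (∀ τ ∈ Ici (0 : ℝ),
      HasDerivWithinAt Φ ((P τ + (Q τ).comp (M τ)).comp (Φ τ)) (Ici 0) τ) ∧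
    ∃ K : ℝ, 0 < K ∧ ∃ lam : ℝ, 0 < lam ∧
      ∀ τ ∈ Ici (0 : ℝ), ‖Φ τ‖ ≤ K * Real.exp (-(lam * τ))

/-- The right-hand side of the auxiliary system, i.e. of the system which
`dc/dτ = α e^{-ατ} g(x̄ + c, d)` becomes in the shifted phase variable
`y = c - totalShift (e^{-ατ})`; its linear part is `linP`, `linQ` up to terms with the coefficients
`e^{-iατ}`, `i > n` (phase variable) and `i > 2n` (control). -/
def auxField {n r : ℕ} (g : Vec n × Vec r → Vec n) (α : ℝ) (xbar : Vec n)
    (τ : ℝ) (y : Vec n) (d : Vec r) : Vec n :=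
  (α * Real.exp (-(α * τ))) • g (xbar + (y + totalShift g xbar (Real.exp (-(α * τ)))), d)
    - deriv (fun ρ : ℝ => totalShift g xbar (Real.exp (-(α * ρ)))) τ

/-- `y` solves on `[0,∞)` the initial value problem for the auxiliary system closed with the
feedback `d = M(τ) y`; the initial value corresponds to `c(0) = -x̄`. -/
def IsAuxIVPSolution {n r : ℕ} (g : Vec n × Vec r → Vec n) (α : ℝ) (xbar : Vec n)
    (M : ℝ → Vec n →L[ℝ] Vec r) (y : ℝ → Vec n) : Prop :=
  y 0 = -xbar - totalShift g xbar 1 ∧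
  ∀ τ ∈ Ici (0 : ℝ), HasDerivWithinAt y (auxField g α xbar τ (y τ) (M τ (y τ))) (Ici 0) τ

/-- The new time `τ`, where `t = 1 - e^{-ατ}`. -/
def newTime (α t : ℝ) : ℝ := -Real.log (1 - t) / α

end SynthControl

end

/-!
The proof takes `α = 1` and writes `s = e^{-τ} = 1 - t`, so that `s` runs from `1` down to `0`.

*The shifted system.* For `θ = (x̄, F)` the shifts cancel the first `4n - 1` Taylor coefficients of
the terms free of state and control (`residual_isBigO`). In the variable `y` the auxiliary system
reads `dy/dτ = s (P(s) y + Q(s) d + R)`, with the polynomials `polyP`, `polyQ` and a disturbance `R`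
bounded by `C ((‖y‖ + ‖d‖)² + sⁿ ‖y‖ + s²ⁿ ‖d‖) + δ s⁴ⁿ⁻¹`. Here `C` is uniform in `θ`, and `δ` is
as small as desired for `θ` near `0`, because all shifts depend continuously on `θ` and vanish for
`θ = 0` (`exists_disturbance_le`).

*The feedback.* Let `q₀ = Q` and `q_{k+1} = P q_k + dq_k/ds`. For `θ = 0` the system is constant and
`q_k = Aᵏ B`, so by the rank condition `q₀, …, q_{n-1}` span the state space, uniformly for `θ` near
`0` (`eventually_chainBounds`). With the Gram matrix `c_{jk} = ∫₀¹ ρᵇ (ρ-1)^{j+k} / (j! k!) dρ` put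
`W(s) = ∑_{j,k<2n} c_{jk} s^{j+k+1} q_j q_k*`, which is the Gramian of the system on the remaining
time interval with the weight `ρᵇ`, Taylor expanded in the backward direction and truncated. An
integration by parts gives the Lyapunov equation
`s W' = -s (P W + W P*) + s q₀ q₀* - b W + O(s^{2n+1})` (`exists_hasDerivAt_gramian`). Since the
Gram matrix is positive definite, `W ≥ c s²ⁿ` (`exists_gramian_bounds`), and the feedback
`M = -½ q₀* W⁻¹` makes the energy `E = ⟪y, W⁻¹ y⟫` satisfy `dE/dτ = -b E + (small terms)`
(`energy_derivative`).

*Trapping.* For `b = 6n + 2` and `μ` large the function `s^{-6n} e^{μ s} E` decreases along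
solutions wherever it equals `e²`: all error terms are either multiplied by an additional factor
`s`, and are absorbed by `e^{μ s}`, or carry the factor `δ`, and are absorbed by the surplus `2`
in `b` (`trapping_inequality`). So solutions starting in the sublevel set exist for all times, with
`y = O(s³ⁿ)` and `M y = O(s²ⁿ)` (`exists_decaying_solution`). For `R = 0` this gives the exponential
stability of the linear system (`exists_fundamental_matrix`), and for the disturbance above it gives
the solution of the auxiliary problem. As `y` and `M y` tend to `0`, the return to the time `t`
solves the boundary value problem up to and including `t = 1` (`exists_isBVPSolution`).
-/

namespace SynthControl

open Metric Filter Topology Asymptotics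
open scoped NNReal InnerProductSpace ContDiff

/-! ### Trapped solutions of locally Lipschitz differential equations -/

section ODE

variable {E : Type*} [NormedAddCommGroup E] [NormedSpace ℝ E]

/-- The radial retraction of a normed space onto the closed ball of radius `R` about `0`. -/
noncomputable def radialRetract (R : ℝ) (y : E) : E := (R / max R ‖y‖) • y

lemma radialRetract_of_norm_le {R : ℝ} (hR : 0 < R) {y : E} (hy : ‖y‖ ≤ R) :
    radialRetract R y = y := by
  simp [radialRetract, max_eq_left hy, div_self hR.ne']

lemma norm_radialRetract_le {R : ℝ} (hR : 0 < R) (y : E) : ‖radialRetract R y‖ ≤ R := by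
  have hm : 0 < max R ‖y‖ := lt_max_of_lt_left hR
  rw [radialRetract, norm_smul, Real.norm_of_nonneg (by positivity), div_mul_eq_mul_div,
    div_le_iff₀ hm]
  gcongr
  exact le_max_right _ _

lemma lipschitzWith_radialRetract {R : ℝ} (hR : 0 < R) :
    LipschitzWith 2 (radialRetract R : E → E) := by
  refine LipschitzWith.of_dist_le_mul fun y z => ?_
  have hy : 0 < max R ‖y‖ := lt_max_of_lt_left hR
  have hz : 0 < max R ‖z‖ := lt_max_of_lt_left hR
  have hsplit : radialRetract R y - radialRetract R z =
      (R / max R ‖y‖) • (y - z) + (R / max R ‖y‖ - R / max R ‖z‖) • z := by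
    simp only [radialRetract, smul_sub, sub_smul]; abel
  have h1 : R / max R ‖y‖ ≤ 1 := (div_le_one hy).2 (le_max_left _ _)
  have h0 : 0 ≤ R / max R ‖y‖ := by positivity
  have h2 : |max R ‖z‖ - max R ‖y‖| ≤ ‖y - z‖ := by
    refine (abs_max_sub_max_le_max R ‖z‖ R ‖y‖).trans ?_
    rw [sub_self, abs_zero, max_eq_right (abs_nonneg _), norm_sub_rev]
    exact abs_norm_sub_norm_le z y
  have h3 : |R / max R ‖y‖ - R / max R ‖z‖| * ‖z‖ ≤ ‖y - z‖ := by
    have : R / max R ‖y‖ - R / max R ‖z‖ =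
        (R / max R ‖y‖) * ((max R ‖z‖ - max R ‖y‖) / max R ‖z‖) := by
      field_simp
    rw [this, abs_mul, abs_of_nonneg h0, abs_div, abs_of_pos hz]
    calc R / max R ‖y‖ * (|max R ‖z‖ - max R ‖y‖| / max R ‖z‖) * ‖z‖
        ≤ 1 * (‖y - z‖ / max R ‖z‖) * max R ‖z‖ := by
          gcongr
          exact le_max_right _ _
      _ = ‖y - z‖ := by field_simp
  rw [dist_eq_norm, hsplit, dist_eq_norm]
  calc _ ≤ ‖(R / max R ‖y‖) • (y - z)‖ + ‖(R / max R ‖y‖ - R / max R ‖z‖) • z‖ := norm_add_le _ _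
    _ ≤ 1 * ‖y - z‖ + ‖y - z‖ := by
        rw [norm_smul, norm_smul, Real.norm_of_nonneg h0, Real.norm_eq_abs]
        gcongr
    _ = _ := by rw [NNReal.coe_ofNat]; ring

/-- A time-dependent vector field on `[0,∞)` that is continuous in time and, on every bounded
time interval and every ball, Lipschitz in space. -/
structure IsLocLipField (X : ℝ → E → E) : Prop where
  continuousOn : ∀ x, ContinuousOn (fun t => X t x) (Ici 0)
  lipschitz : ∀ T R : ℝ, ∃ K : ℝ≥0, ∀ t ∈ Icc 0 T, LipschitzOnWith K (X t) (closedBall 0 R)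

lemma IsLocLipField.eqOn_Icc {X : ℝ → E → E} (hX : IsLocLipField X) {y z : ℝ → E} {T : ℝ}
    (hy : ∀ t ∈ Icc 0 T, HasDerivWithinAt y (X t (y t)) (Icc 0 T) t)
    (hz : ∀ t ∈ Icc 0 T, HasDerivWithinAt z (X t (z t)) (Icc 0 T) t)
    (h0 : y 0 = z 0) : EqOn y z (Icc 0 T) := by
  have hyc : ContinuousOn y (Icc 0 T) := fun t ht => (hy t ht).continuousWithinAt
  have hzc : ContinuousOn z (Icc 0 T) := fun t ht => (hz t ht).continuousWithinAt
  obtain ⟨R₁, hR₁⟩ := isCompact_Icc.exists_bound_of_continuousOn hyc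
  obtain ⟨R₂, hR₂⟩ := isCompact_Icc.exists_bound_of_continuousOn hzc
  obtain ⟨K, hK⟩ := hX.lipschitz T (max R₁ R₂)
  have hIci : ∀ t ∈ Ico (0 : ℝ) T, Icc (0 : ℝ) T ∈ 𝓝[Ici t] t := fun t ht =>
    mem_of_superset (Icc_mem_nhdsGE ht.2) (Icc_subset_Icc_left ht.1)
  refine ODE_solution_unique_of_mem_Icc_right (s := fun _ => closedBall 0 (max R₁ R₂))
    (fun t ht => hK t (Ico_subset_Icc_self ht)) hyc
    (fun t ht => (hy t (Ico_subset_Icc_self ht)).mono_of_mem_nhdsWithin (hIci t ht)) ?_ hzc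
    (fun t ht => (hz t (Ico_subset_Icc_self ht)).mono_of_mem_nhdsWithin (hIci t ht)) ?_ h0
  · intro t ht
    simpa using Or.inl (hR₁ t (Ico_subset_Icc_self ht))
  · intro t ht
    simpa using Or.inr (hR₂ t (Ico_subset_Icc_self ht))

lemma IsLocLipField.eqOn_Ici {X : ℝ → E → E} (hX : IsLocLipField X) {y z : ℝ → E}
    (hy : ∀ t ∈ Ici (0 : ℝ), HasDerivWithinAt y (X t (y t)) (Ici 0) t)
    (hz : ∀ t ∈ Ici (0 : ℝ), HasDerivWithinAt z (X t (z t)) (Ici 0) t)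
    (h0 : y 0 = z 0) : EqOn y z (Ici 0) := fun _ hT =>
  hX.eqOn_Icc (fun t ht => (hy t ht.1).mono Icc_subset_Ici_self)
    (fun t ht => (hz t ht.1).mono Icc_subset_Ici_self) h0 (right_mem_Icc.2 hT)

variable [CompleteSpace E]

/-- The retraction turns a locally Lipschitz field into a bounded, globally Lipschitz one, for
which the Picard iteration converges on the whole of `[0,T]`. -/
lemma IsLocLipField.exists_solution_retract {X : ℝ → E → E} (hX : IsLocLipField X) {T R : ℝ}
    (hT : 0 ≤ T) (hR : 0 < R) (y₀ : E) :
    ∃ y : ℝ → E, y 0 = y₀ ∧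
      ∀ t ∈ Icc 0 T, HasDerivWithinAt y (X t (radialRetract R (y t))) (Icc 0 T) t := by
  obtain ⟨K, hK⟩ := hX.lipschitz T R
  obtain ⟨B, hB⟩ := isCompact_Icc.exists_bound_of_continuousOn
    ((hX.continuousOn 0).mono (Icc_subset_Ici_self : Icc (0 : ℝ) T ⊆ Ici 0))
  have hmem : ∀ x : E, radialRetract R x ∈ closedBall (0 : E) R := fun x => by
    simpa using norm_radialRetract_le hR x
  have hbound : ∀ t ∈ Icc 0 T, ∀ x : E, ‖X t (radialRetract R x)‖ ≤ B + K * R := by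
    intro t ht x
    have h1 := (hK t ht).dist_le_mul _ (hmem x) 0 (by simpa using hR.le)
    rw [dist_eq_norm, dist_zero_right] at h1
    have h2 := norm_radialRetract_le hR x
    have h3 := hB t ht
    have h4 : (K : ℝ) * ‖radialRetract R x‖ ≤ K * R := by gcongr
    linarith [norm_le_norm_sub_add (X t (radialRetract R x)) (X t 0)]
  have hB0 : 0 ≤ B + K * R := (norm_nonneg _).trans (hbound 0 ⟨le_rfl, hT⟩ 0)
  have hPL : IsPicardLindelof (fun t x => X t (radialRetract R x)) (tmin := 0) (tmax := T)
      ⟨0, le_rfl, hT⟩ y₀ (Real.toNNReal ((B + K * R) * T)) 0 (Real.toNNReal (B + K * R))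
      (K * 2) := by
    refine ⟨fun t ht => ?_, fun x _ => (hX.continuousOn _).mono Icc_subset_Ici_self,
      fun t ht x _ => ?_, ?_⟩
    · exact ((hK t ht).comp (lipschitzWith_radialRetract hR).lipschitzOnWith
        (fun x _ => hmem x))
    · rw [Real.coe_toNNReal _ hB0]; exact hbound t ht x
    · rw [Real.coe_toNNReal _ hB0, Real.coe_toNNReal _ (mul_nonneg hB0 hT)]
      simp [hT]
  exact hPL.exists_eq_forall_mem_Icc_hasDerivWithinAt₀

/-- Global existence inside a trapping region: if `U` decreases along the field wherever `U = η`
and the sublevel set `U ≤ η` is bounded on bounded time intervals, then a solution which starts in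
that sublevel set exists, and remains there, for all times. -/
theorem IsLocLipField.exists_trapped_solution {X : ℝ → E → E} (hX : IsLocLipField X) (y₀ : E)
    (U : ℝ → E → ℝ) (η : ℝ) (hU0 : U 0 y₀ ≤ η)
    (hbd : ∀ T, ∃ R, ∀ t ∈ Icc 0 T, ∀ x, U t x ≤ η → ‖x‖ ≤ R)
    (hderiv : ∀ t ∈ Ici (0 : ℝ), ∀ (y : ℝ → E) (v : E) (s : Set ℝ), HasDerivWithinAt y v s t →
      ∃ D, HasDerivWithinAt (fun τ => U τ (y τ)) D s t ∧
        (U t (y t) = η → v = X t (y t) → D < 0)) :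
    ∃ y : ℝ → E, y 0 = y₀ ∧ (∀ t ∈ Ici (0 : ℝ), HasDerivWithinAt y (X t (y t)) (Ici 0) t) ∧
      ∀ t ∈ Ici (0 : ℝ), U t (y t) ≤ η := by
  have hloc : ∀ T : ℝ, 0 ≤ T → ∃ y : ℝ → E, y 0 = y₀ ∧
      (∀ t ∈ Icc 0 T, HasDerivWithinAt y (X t (y t)) (Icc 0 T) t) ∧
      ∀ t ∈ Icc 0 T, U t (y t) ≤ η := by
    intro T hT
    obtain ⟨R, hR⟩ := hbd T
    obtain ⟨y, hy0, hy⟩ := hX.exists_solution_retract hT (lt_max_of_lt_right one_pos : 0 < max R 1)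
      y₀
    have hret : ∀ t ∈ Icc 0 T, U t (y t) ≤ η → radialRetract (max R 1) (y t) = y t :=
      fun t ht hU => radialRetract_of_norm_le (lt_max_of_lt_right one_pos)
        ((hR t ht _ hU).trans (le_max_left _ _))
    choose! D hD hneg using fun t (ht : t ∈ Icc 0 T) => hderiv t ht.1 y _ _ (hy t ht)
    -- on the boundary of the trapping region the retraction acts as the identity, so the
    -- decrease of `U` along the original field can be used for the retracted one
    have htrap : ∀ t ∈ Icc 0 T, U t (y t) ≤ η := by
      intro t ht
      refine image_le_of_deriv_right_lt_deriv_boundary (f := fun τ => U τ (y τ)) (f' := D)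
        (B := fun _ => η) (B' := fun _ => 0) (fun s hs => (hD s hs).continuousWithinAt) ?_
        (by simpa [hy0] using hU0) (fun x => hasDerivAt_const x η) ?_ ht
      · intro s hs
        exact (hD s (Ico_subset_Icc_self hs)).mono_of_mem_nhdsWithin
          (mem_of_superset (Icc_mem_nhdsGE hs.2) (Icc_subset_Icc_left hs.1))
      · intro s hs hs'
        have hs2 := Ico_subset_Icc_self hs
        exact hneg s hs2 hs' (by rw [hret s hs2 hs'.le])
    exact ⟨y, hy0, fun t ht => by simpa only [hret t ht (htrap t ht)] using hy t ht, htrap⟩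
  choose! Y hY0 hY hYU using fun m : ℕ => hloc m m.cast_nonneg
  have hagree : ∀ (m k : ℕ) (t : ℝ), 0 ≤ t → t ≤ m → t ≤ k → Y m t = Y k t := by
    intro m k t h0 hm hk
    refine hX.eqOn_Icc (T := t)
      (fun s hs => (hY m s ⟨hs.1, hs.2.trans hm⟩).mono (Icc_subset_Icc_right hm))
      (fun s hs => (hY k s ⟨hs.1, hs.2.trans hk⟩).mono (Icc_subset_Icc_right hk))
      ((hY0 m).trans (hY0 k).symm) ⟨h0, le_rfl⟩
  have hfl : ∀ t : ℝ, t < ((⌊t⌋₊ + 2 : ℕ) : ℝ) := fun t => by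
    have := Nat.lt_floor_add_one t
    push_cast; linarith
  refine ⟨fun t => Y (⌊t⌋₊ + 2) t, hY0 _, fun t ht => ?_,
    fun t ht => hYU _ t ⟨ht, (hfl t).le⟩⟩
  have hnhds : Icc (0 : ℝ) ((⌊t⌋₊ + 2 : ℕ) : ℝ) ∈ 𝓝[Ici 0] t :=
    inter_mem_nhdsWithin _ (Iic_mem_nhds (hfl t))
  refine ((hY (⌊t⌋₊ + 2) t ⟨ht, (hfl t).le⟩).mono_of_mem_nhdsWithin hnhds).congr_of_eventuallyEq
    ?_ rfl
  filter_upwards [hnhds] with s hs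
  exact hagree _ _ s hs.1 (hfl s).le hs.2

end ODE

/-! ### The moments of the weight `θᵇ` -/

section Moments

/-- The moment `∫₀¹ θᵇ (θ - 1)ˡ dθ`. -/
noncomputable def moment (b l : ℕ) : ℝ := ∫ θ in (0 : ℝ)..1, θ ^ b * (θ - 1) ^ l

lemma moment_zero (b : ℕ) : ((b : ℝ) + 1) * moment b 0 = 1 := by
  simp only [moment, pow_zero, mul_one, integral_pow]
  field_simp
  simp

lemma moment_succ (b l : ℕ) :
    ((b : ℝ) + 1 + (l + 1)) * moment b (l + 1) + (l + 1) * moment b l = 0 := by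
  have hd : ∀ x ∈ uIcc (0 : ℝ) 1, HasDerivAt (fun θ : ℝ => θ ^ (b + 1) * (θ - 1) ^ (l + 1))
      (((b : ℝ) + 1 + (l + 1)) * (x ^ b * (x - 1) ^ (l + 1))
        + (l + 1) * (x ^ b * (x - 1) ^ l)) x := by
    intro x _
    convert! (hasDerivAt_pow (b + 1) x).mul (((hasDerivAt_id x).sub_const 1).pow (l + 1)) using 1
    simp only [id, Nat.add_sub_cancel, Pi.pow_apply]
    push_cast
    ring
  have h := intervalIntegral.integral_eq_sub_of_hasDerivAt hd
    (Continuous.intervalIntegrable (by fun_prop) _ _)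
  rw [intervalIntegral.integral_add (Continuous.intervalIntegrable (by fun_prop) _ _)
    (Continuous.intervalIntegrable (by fun_prop) _ _), intervalIntegral.integral_const_mul,
    intervalIntegral.integral_const_mul] at h
  simpa [moment] using h

/-- The Gram matrix of the polynomials `(θ - 1)ʲ / j!` for the weight `θᵇ` on `[0,1]`. -/
noncomputable def gramCoeff (b j k : ℕ) : ℝ :=
  moment b (j + k) / (j.factorial * k.factorial)

lemma gramCoeff_comm (b j k : ℕ) : gramCoeff b j k = gramCoeff b k j := by
  simp only [gramCoeff, add_comm j k, mul_comm (j.factorial : ℝ)]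

/-- `gramCoeff` with its first index lowered by one, and zero where that is impossible. -/
noncomputable def gramCoeffPred (b : ℕ) : ℕ → ℕ → ℝ
  | 0, _ => 0
  | j + 1, k => gramCoeff b j k

/-- Integration by parts for the Gram matrix: this is the algebraic Lyapunov equation that makes
the weighted Gramian decrease at the rate `b`. -/
lemma gramCoeff_lyapunov (b j k : ℕ) :
    ((b : ℝ) + 1 + j + k) * gramCoeff b j k + gramCoeffPred b j k + gramCoeffPred b k j =
      if j = 0 ∧ k = 0 then 1 else 0 := by
  rcases j with _ | j <;> rcases k with _ | k
  · simpa [gramCoeff, gramCoeffPred] using moment_zero b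
  · have h := moment_succ b k
    have hk : (k.factorial : ℝ) ≠ 0 := by positivity
    simp only [gramCoeff, gramCoeffPred, Nat.factorial_succ, zero_add, Nat.factorial_zero, add_zero]
    push_cast
    simp
    field_simp
    linarith
  · have h := moment_succ b j
    have hj : (j.factorial : ℝ) ≠ 0 := by positivity
    simp only [gramCoeff, gramCoeffPred, Nat.factorial_succ, Nat.factorial_zero, add_zero]
    push_cast
    simp
    field_simp
    linarith
  · have h := moment_succ b (j + k + 1)
    have hj : (j.factorial : ℝ) ≠ 0 := by positivity
    have hk : (k.factorial : ℝ) ≠ 0 := by positivity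
    simp only [gramCoeff, gramCoeffPred, Nat.factorial_succ,
      show j + 1 + (k + 1) = j + k + 1 + 1 by ring, show j + (k + 1) = j + k + 1 by ring,
      show k + (j + 1) = j + k + 1 by ring]
    push_cast at h ⊢
    simp
    field_simp
    linarith

variable {H : Type*} [NormedAddCommGroup H] [InnerProductSpace ℝ H]

/-- The quadratic form with the matrix `gramCoeff`, evaluated at `a₀, …, a_{m-1}`. -/
noncomputable def gramForm (b m : ℕ) (a : ℕ → H) : ℝ :=
  ∑ j ∈ Finset.range m, ∑ k ∈ Finset.range m, gramCoeff b j k * ⟪a j, a k⟫_ℝ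

lemma gramForm_eq_integral (b m : ℕ) (a : ℕ → H) :
    gramForm b m a = ∫ θ in (0 : ℝ)..1,
      θ ^ b * ‖∑ k ∈ Finset.range m, ((θ - 1) ^ k / k.factorial) • a k‖ ^ 2 := by
  have hexp : ∀ θ : ℝ,
      θ ^ b * ‖∑ k ∈ Finset.range m, ((θ - 1) ^ k / k.factorial) • a k‖ ^ 2 =
      ∑ j ∈ Finset.range m, ∑ k ∈ Finset.range m,
        (⟪a j, a k⟫_ℝ / (j.factorial * k.factorial)) * (θ ^ b * (θ - 1) ^ (j + k)) := by
    intro θ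
    rw [← real_inner_self_eq_norm_sq, sum_inner, Finset.mul_sum]
    refine Finset.sum_congr rfl fun j _ => ?_
    rw [inner_sum, Finset.mul_sum]
    refine Finset.sum_congr rfl fun k _ => ?_
    rw [real_inner_smul_left, real_inner_smul_right, pow_add]
    field_simp
  simp_rw [hexp]
  rw [intervalIntegral.integral_finsetSum
    fun _ _ => Continuous.intervalIntegrable (by fun_prop) _ _]
  refine Finset.sum_congr rfl fun j _ => ?_
  rw [intervalIntegral.integral_finsetSum
    fun _ _ => Continuous.intervalIntegrable (by fun_prop) _ _]
  refine Finset.sum_congr rfl fun k _ => ?_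
  rw [intervalIntegral.integral_const_mul, gramCoeff, moment]
  ring

lemma gramForm_nonneg (b m : ℕ) (a : ℕ → H) : 0 ≤ gramForm b m a := by
  rw [gramForm_eq_integral]
  refine intervalIntegral.integral_nonneg zero_le_one fun θ hθ => ?_
  have := hθ.1
  positivity

lemma gramForm_le (b m : ℕ) {a : ℕ → H} {B : ℝ} (ha : ∀ k < m, ‖a k‖ ≤ B) :
    gramForm b m a ≤
      (∑ j ∈ Finset.range m, ∑ k ∈ Finset.range m, |gramCoeff b j k|) * B ^ 2 := by
  simp only [gramForm, Finset.sum_mul]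
  refine Finset.sum_le_sum fun j hj => Finset.sum_le_sum fun k hk => ?_
  rw [Finset.mem_range] at hj hk
  have hB : 0 ≤ B := (norm_nonneg _).trans (ha j hj)
  refine (le_abs_self _).trans ?_
  rw [abs_mul]
  refine mul_le_mul_of_nonneg_left ((abs_real_inner_le_norm _ _).trans ?_) (abs_nonneg _)
  rw [sq]
  exact mul_le_mul (ha j hj) (ha k hk) (norm_nonneg _) hB

lemma abs_sum_gramCoeff_inner_le (b j m : ℕ) {a : ℕ → H} {x : H} {A B : ℝ} (hx : ‖x‖ ≤ A)
    (ha : ∀ k < m, ‖a k‖ ≤ B) :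
    |∑ k ∈ Finset.range m, gramCoeff b j k * ⟪x, a k⟫_ℝ| ≤
      (∑ k ∈ Finset.range m, |gramCoeff b j k|) * (A * B) := by
  rw [Finset.sum_mul]
  refine (Finset.abs_sum_le_sum_abs _ _).trans (Finset.sum_le_sum fun k hk => ?_)
  rw [Finset.mem_range] at hk
  rw [abs_mul]
  exact mul_le_mul_of_nonneg_left ((abs_real_inner_le_norm _ _).trans
    (mul_le_mul hx (ha k hk) (norm_nonneg _) ((norm_nonneg _).trans hx))) (abs_nonneg _)

lemma gramForm_pos {b m : ℕ} {a : ℕ → H} {i : ℕ} (him : i < m) (hi : a i ≠ 0) :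
    0 < gramForm b m a := by
  rw [gramForm_eq_integral]
  have hcont : Continuous fun θ : ℝ =>
      θ ^ b * ‖∑ k ∈ Finset.range m, ((θ - 1) ^ k / k.factorial) • a k‖ ^ 2 := by fun_prop
  refine intervalIntegral.integral_pos zero_lt_one hcont.continuousOn
    (fun θ hθ => by have := hθ.1; positivity) ?_
  by_contra! hcon
  -- a vector polynomial vanishing on `(0,1)` has vanishing coefficients
  have hzero : ∀ θ ∈ Ioo (0 : ℝ) 1,
      ∑ k ∈ Finset.range m, ((θ - 1) ^ k / k.factorial) • a k = 0 := by
    intro θ hθ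
    have h1 := hcon θ (Ioo_subset_Icc_self hθ)
    have h2 : 0 < θ ^ b := pow_pos hθ.1 b
    have h3 : ‖∑ k ∈ Finset.range m, ((θ - 1) ^ k / k.factorial) • a k‖ ^ 2 ≤ 0 := by
      by_contra! h4
      exact absurd (mul_pos h2 h4) (not_lt.2 h1)
    simpa using le_antisymm h3 (sq_nonneg _)
  let p : Polynomial ℝ := ∑ k ∈ Finset.range m, Polynomial.monomial k (⟪a k, a i⟫_ℝ / k.factorial)
  have hp : p = 0 := by
    refine Polynomial.eq_zero_of_infinite_isRoot p
      ((Ioo_infinite (show (-1 : ℝ) < 0 by norm_num)).mono fun x hx => ?_)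
    have h1 := congrArg (fun v => ⟪v, a i⟫_ℝ)
      (hzero (x + 1) ⟨by linarith [hx.1], by linarith [hx.2]⟩)
    simp only [sum_inner, real_inner_smul_left, add_sub_cancel_right, inner_zero_left] at h1
    simp only [p, mem_ofPred_eq, Polynomial.IsRoot.def, Polynomial.eval_finsetSum,
      Polynomial.eval_monomial]
    rw [← h1]
    exact Finset.sum_congr rfl fun k _ => by ring
  have hc := congrArg (fun q => Polynomial.coeff q i) hp
  simp only [p, Polynomial.finsetSum_coeff, Polynomial.coeff_monomial, Polynomial.coeff_zero] at hc
  rw [Finset.sum_ite_eq' (Finset.range m) i, if_pos (Finset.mem_range.2 him)] at hc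
  have hfac : (i.factorial : ℝ) ≠ 0 := by positivity
  rw [div_eq_zero_iff, or_iff_left hfac] at hc
  exact hi (inner_self_eq_zero.1 hc)

lemma gramForm_congr {b m : ℕ} {a a' : ℕ → H} (h : ∀ k < m, a k = a' k) :
    gramForm b m a = gramForm b m a' :=
  Finset.sum_congr rfl fun j hj => Finset.sum_congr rfl fun k hk => by
    rw [h j (Finset.mem_range.1 hj), h k (Finset.mem_range.1 hk)]

lemma gramForm_smul (b m : ℕ) (c : ℝ) (a : ℕ → H) :
    gramForm b m (fun k => c • a k) = c ^ 2 * gramForm b m a := by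
  simp only [gramForm, Finset.mul_sum, real_inner_smul_left, real_inner_smul_right]
  exact Finset.sum_congr rfl fun j _ => Finset.sum_congr rfl fun k _ => by ring

/-- The form is coercive, by compactness of the unit sphere. -/
lemma exists_gramForm_coercive (H : Type*) [NormedAddCommGroup H] [InnerProductSpace ℝ H]
    [FiniteDimensional ℝ H] (b m : ℕ) :
    ∃ κ : ℝ, 0 < κ ∧ ∀ a : ℕ → H, ∀ k < m, κ * ‖a k‖ ^ 2 ≤ gramForm b m a := by
  let ext : (Fin m → H) → ℕ → H := fun a k => if h : k < m then a ⟨k, h⟩ else 0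
  have hext : ∀ k, Continuous fun a : Fin m → H => ext a k := by
    intro k
    by_cases hk : k < m
    · simpa [ext, hk] using continuous_apply _
    · simpa [ext, hk] using continuous_const
  have hcont : Continuous fun a : Fin m → H => gramForm b m (ext a) := by
    unfold gramForm
    fun_prop
  obtain ⟨κ, hκ, hmin⟩ := (isCompact_sphere (0 : Fin m → H) 1).exists_forall_le'
    hcont.continuousOn (a := 0) (by
      intro a ha
      have ha0 : a ≠ 0 := by
        rintro rfl
        simp at ha
      obtain ⟨i, hi⟩ := Function.ne_iff.1 ha0
      exact gramForm_pos i.2 (by simpa [ext] using hi))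
  refine ⟨κ, hκ, fun a k hk => ?_⟩
  let a' : Fin m → H := fun i => a i
  have haa : gramForm b m a = gramForm b m (ext a') :=
    gramForm_congr fun j hj => by simp [ext, a', hj]
  have hle : ‖a k‖ ≤ ‖a'‖ := norm_le_pi_norm a' ⟨k, hk⟩
  rcases eq_or_ne a' 0 with h0 | h0
  · have : a k = 0 := congrFun h0 ⟨k, hk⟩
    simpa [this] using gramForm_nonneg b m a
  · have hn : ‖a'‖ ≠ 0 := norm_ne_zero_iff.2 h0
    have h1 := hmin (‖a'‖⁻¹ • a') (by simp [norm_smul, hn])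
    have h2 : ext (‖a'‖⁻¹ • a') = fun j => ‖a'‖⁻¹ • ext a' j := by
      funext j
      by_cases hj : j < m <;> simp [ext, hj]
    rw [h2, gramForm_smul] at h1
    calc κ * ‖a k‖ ^ 2 ≤ (‖a'‖⁻¹ ^ 2 * gramForm b m (ext a')) * ‖a'‖ ^ 2 := by
          gcongr
          exact hκ.le.trans h1
      _ = gramForm b m a := by rw [haa]; field_simp

/-- The Lyapunov equation for `gramForm`. The left-hand side is the derivative of the form along a
chain in which the `j`-th entry is fed by the `(j+1)`-st and scales like the power `j + 1/2`; the
truncation of the chain leaves the last sum. -/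
lemma gramForm_lyapunov (b m : ℕ) (a : ℕ → H) :
    ∑ j ∈ Finset.range (m + 1), ∑ k ∈ Finset.range (m + 1),
      gramCoeff b j k * (((j : ℝ) + k + 1) * ⟪a j, a k⟫_ℝ
        + (⟪a (j + 1), a k⟫_ℝ + ⟪a j, a (k + 1)⟫_ℝ)) =
      ‖a 0‖ ^ 2 - b * gramForm b (m + 1) a
        + 2 * ∑ k ∈ Finset.range (m + 1), gramCoeff b m k * ⟪a (m + 1), a k⟫_ℝ := by
  have hshift : ∀ k, ∑ j ∈ Finset.range (m + 1), gramCoeff b j k * ⟪a (j + 1), a k⟫_ℝ =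
      ∑ j ∈ Finset.range (m + 1), gramCoeffPred b j k * ⟪a j, a k⟫_ℝ
        + gramCoeff b m k * ⟪a (m + 1), a k⟫_ℝ := by
    intro k
    have h1 := Finset.sum_range_succ' (fun j => gramCoeffPred b j k * ⟪a j, a k⟫_ℝ) (m + 1)
    have h2 := Finset.sum_range_succ (fun j => gramCoeffPred b j k * ⟪a j, a k⟫_ℝ) (m + 1)
    simp only [gramCoeffPred, zero_mul, add_zero] at h1 h2
    exact h1.symm.trans h2
  have hleft : ∑ j ∈ Finset.range (m + 1), ∑ k ∈ Finset.range (m + 1),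
      gramCoeff b j k * ⟪a (j + 1), a k⟫_ℝ =
      ∑ j ∈ Finset.range (m + 1), ∑ k ∈ Finset.range (m + 1), gramCoeffPred b j k * ⟪a j, a k⟫_ℝ
        + ∑ k ∈ Finset.range (m + 1), gramCoeff b m k * ⟪a (m + 1), a k⟫_ℝ := by
    rw [Finset.sum_comm, Finset.sum_congr rfl fun k _ => hshift k, Finset.sum_add_distrib,
      Finset.sum_comm]
  have hright : ∑ j ∈ Finset.range (m + 1), ∑ k ∈ Finset.range (m + 1),
      gramCoeff b j k * ⟪a j, a (k + 1)⟫_ℝ =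
      ∑ j ∈ Finset.range (m + 1), ∑ k ∈ Finset.range (m + 1), gramCoeffPred b k j * ⟪a j, a k⟫_ℝ
        + ∑ k ∈ Finset.range (m + 1), gramCoeff b m k * ⟪a (m + 1), a k⟫_ℝ := by
    have h1 : ∑ j ∈ Finset.range (m + 1), ∑ k ∈ Finset.range (m + 1),
        gramCoeff b j k * ⟪a j, a (k + 1)⟫_ℝ = ∑ j ∈ Finset.range (m + 1),
        ∑ k ∈ Finset.range (m + 1), gramCoeff b j k * ⟪a (j + 1), a k⟫_ℝ := by
      rw [Finset.sum_comm]
      exact Finset.sum_congr rfl fun j _ => Finset.sum_congr rfl fun k _ => by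
        rw [gramCoeff_comm, real_inner_comm]
    rw [h1, hleft, Finset.sum_comm]
    congr 1
    exact Finset.sum_congr rfl fun j _ => Finset.sum_congr rfl fun k _ => by
      rw [real_inner_comm]
  have hpoint : ∑ j ∈ Finset.range (m + 1), ∑ k ∈ Finset.range (m + 1),
      (if j = 0 ∧ k = 0 then (1 : ℝ) else 0) * ⟪a j, a k⟫_ℝ = ‖a 0‖ ^ 2 := by
    rw [Finset.sum_eq_single 0, Finset.sum_eq_single 0]
    · simp
    · intro k _ hk
      simp [hk]
    · simp
    · intro j _ hj
      simp [hj]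
    · simp
  simp_rw [← gramCoeff_lyapunov b] at hpoint
  have hsplit : ∑ j ∈ Finset.range (m + 1), ∑ k ∈ Finset.range (m + 1),
      gramCoeff b j k * (((j : ℝ) + k + 1) * ⟪a j, a k⟫_ℝ
        + (⟪a (j + 1), a k⟫_ℝ + ⟪a j, a (k + 1)⟫_ℝ)) =
      ∑ j ∈ Finset.range (m + 1), ∑ k ∈ Finset.range (m + 1),
        gramCoeff b j k * (((j : ℝ) + k + 1) * ⟪a j, a k⟫_ℝ)
      + (∑ j ∈ Finset.range (m + 1), ∑ k ∈ Finset.range (m + 1),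
          gramCoeff b j k * ⟪a (j + 1), a k⟫_ℝ
        + ∑ j ∈ Finset.range (m + 1), ∑ k ∈ Finset.range (m + 1),
          gramCoeff b j k * ⟪a j, a (k + 1)⟫_ℝ) := by
    simp only [← Finset.sum_add_distrib, ← mul_add]
  have hpoint' : ∑ j ∈ Finset.range (m + 1), ∑ k ∈ Finset.range (m + 1),
        gramCoeff b j k * (((j : ℝ) + k + 1) * ⟪a j, a k⟫_ℝ) + b * gramForm b (m + 1) a
      + (∑ j ∈ Finset.range (m + 1), ∑ k ∈ Finset.range (m + 1), gramCoeffPred b j k * ⟪a j, a k⟫_ℝ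
        + ∑ j ∈ Finset.range (m + 1), ∑ k ∈ Finset.range (m + 1),
          gramCoeffPred b k j * ⟪a j, a k⟫_ℝ) = ‖a 0‖ ^ 2 := by
    rw [← hpoint, gramForm]
    simp only [Finset.mul_sum, ← Finset.sum_add_distrib]
    exact Finset.sum_congr rfl fun j _ => Finset.sum_congr rfl fun k _ => by ring
  rw [hsplit, hleft, hright]
  linarith

end Moments

/-! ### The weighted Gramian and its Lyapunov equation -/

section Gramian

variable {V U : Type*} [NormedAddCommGroup V] [InnerProductSpace ℝ V] [CompleteSpace V]
  [NormedAddCommGroup U] [InnerProductSpace ℝ U] [CompleteSpace U]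

open ContinuousLinearMap (adjoint)

lemma _root_.HasDerivAt.clm_adjoint {q : ℝ → U →L[ℝ] V} {q' : U →L[ℝ] V} {s : ℝ}
    (h : HasDerivAt q q' s) : HasDerivAt (fun t => adjoint (q t)) (adjoint q') s := by
  rw [hasDerivAt_iff_isLittleO] at h ⊢
  refine h.norm_left.congr_left (fun t => ?_) |>.of_norm_left
  rw [← LinearIsometryEquiv.norm_map (adjoint : (U →L[ℝ] V) ≃ₗᵢ⋆[ℝ] (V →L[ℝ] U))]
  simp [map_sub]

/-- The weighted Gramian `∑ c_{jk} s^{j+k+1} q_j q_k*` of a chain of operators, where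
`c_{jk} = gramCoeff b j k`. If `q₀` is the
control operator of a linear system in the time `1 - s` and `q_k` are its successive brackets with
the drift, this is (up to truncation) the controllability Gramian of the remaining time interval of
length `s`, for the weight `θᵇ`. -/
noncomputable def gramian (b m : ℕ) (q : ℕ → ℝ → U →L[ℝ] V) (s : ℝ) : V →L[ℝ] V :=
  ∑ j ∈ Finset.range m, ∑ k ∈ Finset.range m,
    (gramCoeff b j k * s ^ (j + k + 1)) • (q j s).comp (adjoint (q k s))

lemma inner_gramian (b m : ℕ) (q : ℕ → ℝ → U →L[ℝ] V) (s : ℝ) (w z : V) :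
    ⟪gramian b m q s w, z⟫_ℝ = ∑ j ∈ Finset.range m, ∑ k ∈ Finset.range m,
      (gramCoeff b j k * s ^ (j + k + 1)) * ⟪adjoint (q k s) w, adjoint (q j s) z⟫_ℝ := by
  simp only [gramian, sum_apply, sum_inner, smul_apply,
    real_inner_smul_left, ContinuousLinearMap.comp_apply, ContinuousLinearMap.adjoint_inner_right]

lemma inner_gramian_comm (b m : ℕ) (q : ℕ → ℝ → U →L[ℝ] V) (s : ℝ) (w z : V) :
    ⟪gramian b m q s w, z⟫_ℝ = ⟪w, gramian b m q s z⟫_ℝ := by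
  rw [real_inner_comm _ w, inner_gramian, inner_gramian, Finset.sum_comm]
  refine Finset.sum_congr rfl fun j _ => Finset.sum_congr rfl fun k _ => ?_
  rw [gramCoeff_comm, add_comm k j, real_inner_comm]

lemma inner_gramian_self (b m : ℕ) (q : ℕ → ℝ → U →L[ℝ] V) (s : ℝ) (w : V) :
    ⟪gramian b m q s w, w⟫_ℝ = s * gramForm b m (fun k => s ^ k • adjoint (q k s) w) := by
  rw [inner_gramian, gramForm, Finset.mul_sum]
  refine Finset.sum_congr rfl fun j _ => ?_
  rw [Finset.mul_sum]
  refine Finset.sum_congr rfl fun k _ => ?_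
  rw [real_inner_smul_left, real_inner_smul_right, real_inner_comm]
  ring

/-- The Lyapunov equation of the weighted Gramian:
`dW/ds = -(P W + W P*) + q₀ q₀* - (b/s) W + (truncation error of order s^{m+1})`. -/
lemma exists_hasDerivAt_gramian (b m : ℕ) {P : ℝ → V →L[ℝ] V} {q : ℕ → ℝ → U →L[ℝ] V}
    (hq : ∀ k s, HasDerivAt (q k) (q (k + 1) s - (P s).comp (q k s)) s) (s : ℝ) :
    ∃ D : V →L[ℝ] V, HasDerivAt (gramian b (m + 1) q) D s ∧ ∀ w : V,
      s * ⟪D w, w⟫_ℝ = -2 * s * ⟪P s (gramian b (m + 1) q s w), w⟫_ℝ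
        + s * ‖adjoint (q 0 s) w‖ ^ 2 - b * ⟪gramian b (m + 1) q s w, w⟫_ℝ
        + 2 * s * ∑ k ∈ Finset.range (m + 1), gramCoeff b m k *
          ⟪s ^ (m + 1) • adjoint (q (m + 1) s) w, s ^ k • adjoint (q k s) w⟫_ℝ := by
  let q' : ℕ → U →L[ℝ] V := fun k => q (k + 1) s - (P s).comp (q k s)
  refine ⟨∑ j ∈ Finset.range (m + 1), ∑ k ∈ Finset.range (m + 1),
    ((gramCoeff b j k * s ^ (j + k + 1)) • ((q' j).comp (adjoint (q k s))
      + (q j s).comp (adjoint (q' k)))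
      + (gramCoeff b j k * ((j + k + 1 : ℕ) * s ^ (j + k))) • (q j s).comp (adjoint (q k s))),
    ?_, fun w => ?_⟩
  · refine HasDerivAt.fun_sum fun j _ => HasDerivAt.fun_sum fun k _ => ?_
    have h1 := (hq j s).clm_comp (hq k s).clm_adjoint
    have h2 := (hasDerivAt_pow (j + k + 1) s).const_mul (gramCoeff b j k)
    exact h2.fun_smul h1
  · have hqi : ∀ j x z, ⟪q j s x, z⟫_ℝ = ⟪x, adjoint (q j s) z⟫_ℝ := fun j x z =>
      (ContinuousLinearMap.adjoint_inner_right _ _ _).symm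
    have hPi : ∀ x z, ⟪P s x, z⟫_ℝ = ⟪x, adjoint (P s) z⟫_ℝ := fun x z =>
      (ContinuousLinearMap.adjoint_inner_right _ _ _).symm
    have h1 := inner_gramian b (m + 1) q s w (adjoint (P s) w)
    have h2 := inner_gramian b (m + 1) q s (adjoint (P s) w) w
    rw [inner_gramian_comm, real_inner_comm] at h2
    rw [ContinuousLinearMap.adjoint_inner_right] at h1 h2
    have h3 := gramForm_lyapunov b m (fun k => s ^ k • adjoint (q k s) w)
    have h4 := inner_gramian_self b (m + 1) q s w
    have hsum : ⟪(∑ j ∈ Finset.range (m + 1), ∑ k ∈ Finset.range (m + 1),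
      ((gramCoeff b j k * s ^ (j + k + 1)) • ((q' j).comp (adjoint (q k s))
        + (q j s).comp (adjoint (q' k)))
        + (gramCoeff b j k * ((j + k + 1 : ℕ) * s ^ (j + k))) •
          (q j s).comp (adjoint (q k s)))) w, w⟫_ℝ
      + (⟪P s (gramian b (m + 1) q s w), w⟫_ℝ + ⟪P s (gramian b (m + 1) q s w), w⟫_ℝ)
      = ‖s ^ 0 • adjoint (q 0 s) w‖ ^ 2
        - b * gramForm b (m + 1) (fun k => s ^ k • adjoint (q k s) w)
        + 2 * ∑ k ∈ Finset.range (m + 1), gramCoeff b m k *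
          ⟪s ^ (m + 1) • adjoint (q (m + 1) s) w, s ^ k • adjoint (q k s) w⟫_ℝ := by
      rw [← h3]
      nth_rw 1 [h1]
      rw [h2]
      simp only [sum_apply, sum_inner, smul_apply,
        add_apply, inner_add_left,
        real_inner_smul_left, ContinuousLinearMap.comp_apply, ← Finset.sum_add_distrib]
      refine Finset.sum_congr rfl fun j _ => Finset.sum_congr rfl fun k _ => ?_
      simp only [q', map_sub, sub_apply, ContinuousLinearMap.comp_apply,
        inner_sub_left, ContinuousLinearMap.adjoint_comp, real_inner_smul_right]
      simp only [hqi, hPi]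
      rw [real_inner_comm (adjoint (q j s) w) (adjoint (q k s) w),
        real_inner_comm (adjoint (q j s) w) (adjoint (q (k + 1) s) w),
        real_inner_comm (adjoint (q (j + 1) s) w) (adjoint (q k s) w)]
      push_cast
      ring
    rw [h4]
    simp only [pow_zero, one_smul] at hsum
    linear_combination s * hsum

/-- Along a curve `y`, the energy `⟪y, W⁻¹ y⟫` of a self-adjoint operator function `W` taken at
`s = e^{-τ}`. -/
lemma hasDerivWithinAt_energy {W : ℝ → V →L[ℝ] V} {D : V →L[ℝ] V} {y : ℝ → V} {v : V}
    {S : Set ℝ} {τ : ℝ} (hW : HasDerivAt W D (Real.exp (-τ))) (hunit : IsUnit (W (Real.exp (-τ))))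
    (hsym : ∀ a c, ⟪W (Real.exp (-τ)) a, c⟫_ℝ = ⟪a, W (Real.exp (-τ)) c⟫_ℝ)
    (hy : HasDerivWithinAt y v S τ) :
    HasDerivWithinAt (fun t => ⟪y t, Ring.inverse (W (Real.exp (-t))) (y t)⟫_ℝ)
      (2 * ⟪v, Ring.inverse (W (Real.exp (-τ))) (y τ)⟫_ℝ + Real.exp (-τ) *
        ⟪D (Ring.inverse (W (Real.exp (-τ))) (y τ)), Ring.inverse (W (Real.exp (-τ))) (y τ)⟫_ℝ)
      S τ := by
  obtain ⟨u, hu⟩ := hunit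
  have hexp : HasDerivAt (fun t : ℝ => Real.exp (-t)) (-Real.exp (-τ)) τ := by
    simpa using (hasDerivAt_neg τ).exp
  have h1 : HasDerivAt (fun t => W (Real.exp (-t))) (-Real.exp (-τ) • D) τ :=
    HasDerivAt.scomp (h := fun t : ℝ => Real.exp (-t)) τ hW hexp
  have h2 : HasFDerivAt Ring.inverse
      (-ContinuousLinearMap.mulLeftRight ℝ (V →L[ℝ] V) ↑u⁻¹ ↑u⁻¹) (W (Real.exp (-τ))) := by
    rw [← hu]; exact hasFDerivAt_ringInverse u
  have h3 := h2.comp_hasDerivAt τ h1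
  have h4 := hy.inner ℝ (h3.hasDerivWithinAt.clm_apply hy)
  have hinv : Ring.inverse (W (Real.exp (-τ))) = ↑u⁻¹ := by rw [← hu, Ring.inverse_unit]
  have hWinv : ∀ a, W (Real.exp (-τ)) ((↑u⁻¹ : V →L[ℝ] V) a) = a := fun a => by
    rw [← hu, ← mul_apply_eq_comp, u.mul_inv, one_apply_eq_self]
  have hinvsym : ∀ a c, ⟪(↑u⁻¹ : V →L[ℝ] V) a, c⟫_ℝ = ⟪a, (↑u⁻¹ : V →L[ℝ] V) c⟫_ℝ := fun a c => by
    rw [← hWinv c, ← hsym, hWinv, hWinv]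
  convert! h4 using 1
  simp only [Function.comp, hinv, neg_apply, inner_add_right,
    ContinuousLinearMap.mulLeftRight_apply, mul_apply_eq_comp, inner_neg_right,
    smul_apply, map_smul, real_inner_smul_right, neg_smul, map_neg,
    mul_neg, neg_neg]
  rw [← hinvsym (y τ) v, ← hinvsym (y τ) (D _), real_inner_comm v, real_inner_comm (D _)]
  ring

end Gramian

/-! ### The Gramian feedback and a priori bounds -/

section Feedback

variable {V U : Type*} [NormedAddCommGroup V] [InnerProductSpace ℝ V] [CompleteSpace V]
  [NormedAddCommGroup U] [InnerProductSpace ℝ U] [CompleteSpace U]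

open ContinuousLinearMap (adjoint)

/-- `q₀, q₁, …` is the chain of brackets `q_{k+1} = P q_k + dq_k/ds` of a control operator `q₀`
with the drift `P`, bounded by `C` up to the order `2n`, and its first `n` members span the state
space, quantitatively with the constant `κ`. -/
structure ChainBounds (n : ℕ) (C κ : ℝ) (P : ℝ → V →L[ℝ] V)
    (q : ℕ → ℝ → U →L[ℝ] V) : Prop where
  hasDerivAt : ∀ k s, HasDerivAt (q k) (q (k + 1) s - (P s).comp (q k s)) s
  norm_le : ∀ k ≤ 2 * n, ∀ s ∈ Icc (0 : ℝ) 1, ‖q k s‖ ≤ C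
  lower : ∀ s ∈ Icc (0 : ℝ) 1, ∀ w, ∃ k < n, κ * ‖w‖ ≤ ‖adjoint (q k s) w‖

variable (V U) in
/-- Coercivity, boundedness and smallness of the truncation error of the Gramian, with constants
which depend only on the bounds of the chain. The member `q_k`, `k < n`, which does not annihilate
`w` contributes the order `s^{2k+1} ≥ s^{2n}`. -/
lemma exists_gramian_bounds [FiniteDimensional ℝ U] (b : ℕ) {n m : ℕ} (hm : m + 1 = 2 * n)
    {C κ : ℝ} (hκ : 0 < κ) :
    ∃ c C' : ℝ, 0 < c ∧ 0 < C' ∧ ∀ (P : ℝ → V →L[ℝ] V) (q : ℕ → ℝ → U →L[ℝ] V),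
      ChainBounds n C κ P q → ∀ s ∈ Ioc (0 : ℝ) 1, ∀ w : V,
        c * s ^ (2 * n) * ‖w‖ ^ 2 ≤ ⟪gramian b (m + 1) q s w, w⟫_ℝ ∧
        ⟪gramian b (m + 1) q s w, w⟫_ℝ ≤ C' * ‖w‖ ^ 2 ∧
        |∑ k ∈ Finset.range (m + 1), gramCoeff b m k *
          ⟪s ^ (m + 1) • adjoint (q (m + 1) s) w, s ^ k • adjoint (q k s) w⟫_ℝ| ≤
          C' * s ^ (2 * n) * ‖w‖ ^ 2 := by
  obtain ⟨κ₀, hκ₀, hcoer⟩ := exists_gramForm_coercive U b (m + 1)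
  obtain ⟨G₁, hG₁⟩ : ∃ G, G = ∑ j ∈ Finset.range (m + 1), ∑ k ∈ Finset.range (m + 1),
    |gramCoeff b j k| := ⟨_, rfl⟩
  obtain ⟨G₂, hG₂⟩ : ∃ G, G = ∑ k ∈ Finset.range (m + 1), |gramCoeff b m k| := ⟨_, rfl⟩
  have hG₁0 : 0 ≤ G₁ := hG₁ ▸ Finset.sum_nonneg fun _ _ => Finset.sum_nonneg fun _ _ => abs_nonneg _
  have hG₂0 : 0 ≤ G₂ := hG₂ ▸ Finset.sum_nonneg fun _ _ => abs_nonneg _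
  refine ⟨κ₀ * κ ^ 2, (G₁ + G₂) * C ^ 2 + 1, by positivity, by positivity, ?_⟩
  intro P q hq s hs w
  have hs0 := hs.1
  have hs' : s ∈ Icc (0 : ℝ) 1 := ⟨hs.1.le, hs.2⟩
  have hC : 0 ≤ C := (norm_nonneg _).trans (hq.norm_le 0 (Nat.zero_le _) s hs')
  have hadj : ∀ k ≤ 2 * n, ‖adjoint (q k s) w‖ ≤ C * ‖w‖ := fun k hk =>
    (ContinuousLinearMap.le_opNorm _ _).trans (by
      rw [LinearIsometryEquiv.norm_map]
      exact mul_le_mul_of_nonneg_right (hq.norm_le k hk s hs') (norm_nonneg _))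
  have hnorm : ∀ k, ‖s ^ k • adjoint (q k s) w‖ = s ^ k * ‖adjoint (q k s) w‖ := fun k => by
    rw [norm_smul, Real.norm_of_nonneg (pow_nonneg hs0.le k)]
  have hadj' : ∀ k < m + 1, ‖s ^ k • adjoint (q k s) w‖ ≤ C * ‖w‖ := fun k hk => by
    rw [hnorm]
    calc s ^ k * ‖adjoint (q k s) w‖ ≤ 1 * (C * ‖w‖) := by
          gcongr
          · exact pow_le_one₀ hs0.le hs.2
          · exact hadj k (by omega)
      _ = C * ‖w‖ := one_mul _
  refine ⟨?_, ?_, ?_⟩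
  · obtain ⟨k, hk, hlow⟩ := hq.lower s hs' w
    rw [inner_gramian_self]
    have h1 := hcoer (fun k => s ^ k • adjoint (q k s) w) k (by omega)
    have h2 : s ^ (2 * n) ≤ s * (s ^ k) ^ 2 := by
      rw [← pow_mul, ← pow_succ']
      exact pow_le_pow_of_le_one hs0.le hs.2 (by omega)
    calc κ₀ * κ ^ 2 * s ^ (2 * n) * ‖w‖ ^ 2
        ≤ κ₀ * κ ^ 2 * (s * (s ^ k) ^ 2) * ‖w‖ ^ 2 := by gcongr
      _ = s * (κ₀ * (s ^ k * (κ * ‖w‖)) ^ 2) := by ring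
      _ ≤ s * (κ₀ * (s ^ k * ‖adjoint (q k s) w‖) ^ 2) := by gcongr
      _ = s * (κ₀ * ‖s ^ k • adjoint (q k s) w‖ ^ 2) := by rw [hnorm]
      _ ≤ _ := mul_le_mul_of_nonneg_left h1 hs0.le
  · rw [inner_gramian_self]
    calc s * gramForm b (m + 1) (fun k => s ^ k • adjoint (q k s) w)
        ≤ 1 * (G₁ * (C * ‖w‖) ^ 2) := by
          refine mul_le_mul hs.2 ?_ (gramForm_nonneg _ _ _) zero_le_one
          rw [hG₁]
          exact gramForm_le b (m + 1) hadj'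
      _ = G₁ * C ^ 2 * ‖w‖ ^ 2 := by ring
      _ ≤ ((G₁ + G₂) * C ^ 2 + 1) * ‖w‖ ^ 2 := by
          refine mul_le_mul_of_nonneg_right ?_ (sq_nonneg _)
          nlinarith [mul_nonneg hG₂0 (sq_nonneg C)]
  · have h1 : ‖s ^ (m + 1) • adjoint (q (m + 1) s) w‖ ≤ s ^ (2 * n) * (C * ‖w‖) := by
      rw [hnorm, hm]
      exact mul_le_mul_of_nonneg_left (hadj _ le_rfl) (pow_nonneg hs0.le _)
    calc _ ≤ G₂ * (s ^ (2 * n) * (C * ‖w‖) * (C * ‖w‖)) := by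
          rw [hG₂]
          exact abs_sum_gramCoeff_inner_le b m (m + 1) h1 hadj'
      _ = G₂ * C ^ 2 * (s ^ (2 * n) * ‖w‖ ^ 2) := by ring
      _ ≤ ((G₁ + G₂) * C ^ 2 + 1) * (s ^ (2 * n) * ‖w‖ ^ 2) := by
          refine mul_le_mul_of_nonneg_right ?_ (by positivity)
          nlinarith [mul_nonneg hG₁0 (sq_nonneg C)]
      _ = _ := by ring

/-- The feedback `-½ q₀* W⁻¹` at the time `τ`, where `s = e^{-τ}`. -/
noncomputable def gramFeedback (b m : ℕ) (q : ℕ → ℝ → U →L[ℝ] V) (τ : ℝ) : V →L[ℝ] U :=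
  -(1 / 2 : ℝ) • (adjoint (q 0 (Real.exp (-τ)))).comp
    (Ring.inverse (gramian b m q (Real.exp (-τ))))

lemma isUnit_gramian {b m n : ℕ} {q : ℕ → ℝ → U →L[ℝ] V} {c s : ℝ} (hc : 0 < c) (hs : 0 < s)
    (h : ∀ w, c * s ^ (2 * n) * ‖w‖ ^ 2 ≤ ⟪gramian b m q s w, w⟫_ℝ) :
    IsUnit (gramian b m q s) := by
  have h0 : 0 < c * s ^ (2 * n) := by positivity
  refine ContinuousLinearMap.isUnit_of_forall_le_norm_inner_map _ (c := ⟨_, h0.le⟩) h0 fun x => ?_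
  rw [mul_comm]
  exact (h x).trans (le_abs_self _)

/-- The a priori estimates: an energy of size `s^{6n} z²` controls the costate `W⁻¹ y`, the state
and the feedback control. -/
lemma energy_bounds {b m n : ℕ} {q : ℕ → ℝ → U →L[ℝ] V} {c C C' K s z : ℝ} {y w : V} (hc : 0 < c)
    (hC' : 0 < C') (hC : 0 ≤ C) (hs : s ∈ Ioc (0 : ℝ) 1) (hz : 0 ≤ z) (hK : 1 ≤ K)
    (hKc : 1 ≤ K * c) (hKC' : C' ≤ K)
    (hlow : ∀ w, c * s ^ (2 * n) * ‖w‖ ^ 2 ≤ ⟪gramian b m q s w, w⟫_ℝ)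
    (hup : ∀ w, ⟪gramian b m q s w, w⟫_ℝ ≤ C' * ‖w‖ ^ 2) (hq : ‖q 0 s‖ ≤ C)
    (hy : gramian b m q s w = y) (hV : ⟪y, w⟫_ℝ ≤ s ^ (6 * n) * z ^ 2) :
    ‖w‖ ≤ K * (s ^ (2 * n) * z) ∧ ‖y‖ ≤ K * (s ^ (3 * n) * z) ∧
      ‖-(1 / 2 : ℝ) • adjoint (q 0 s) w‖ ≤ C * K * (s ^ (2 * n) * z) := by
  have hs0 := hs.1
  have hw : ‖w‖ ≤ K * (s ^ (2 * n) * z) := by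
    refine abs_le_of_sq_le_sq' ?_ (by positivity) |>.2
    have h1 := (hy ▸ hlow w).trans hV
    have h2 : c * ‖w‖ ^ 2 ≤ s ^ (4 * n) * z ^ 2 := by
      refine le_of_mul_le_mul_left ?_ (pow_pos hs0 (2 * n))
      calc s ^ (2 * n) * (c * ‖w‖ ^ 2) = c * s ^ (2 * n) * ‖w‖ ^ 2 := by ring
        _ ≤ s ^ (6 * n) * z ^ 2 := h1
        _ = s ^ (2 * n) * (s ^ (4 * n) * z ^ 2) := by ring
    calc ‖w‖ ^ 2 = 1 * ‖w‖ ^ 2 := by ring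
      _ ≤ K * c * ‖w‖ ^ 2 := by gcongr
      _ = K * (c * ‖w‖ ^ 2) := by ring
      _ ≤ K * (s ^ (4 * n) * z ^ 2) := by gcongr
      _ ≤ K ^ 2 * (s ^ (4 * n) * z ^ 2) := by
          gcongr
          exact le_self_pow₀ hK (by norm_num)
      _ = _ := by ring
  refine ⟨hw, ?_, ?_⟩
  · -- positivity of the Gramian at `w - y / C'` gives `‖y‖² ≤ C' ⟪y, w⟫`
    have h1 : ‖y‖ ^ 2 ≤ C' * ⟪y, w⟫_ℝ := by
      have h2 := hlow (w - C'⁻¹ • y)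
      have h3 : 0 ≤ c * s ^ (2 * n) * ‖w - C'⁻¹ • y‖ ^ 2 := by positivity
      have h4 := h3.trans h2
      have h5 := hup y
      have h6 : ⟪gramian b m q s y, w⟫_ℝ = ‖y‖ ^ 2 := by
        rw [inner_gramian_comm, hy, real_inner_self_eq_norm_sq]
      simp only [map_sub, map_smul, inner_sub_left, inner_sub_right, real_inner_smul_left,
        real_inner_smul_right, hy, h6, real_inner_self_eq_norm_sq] at h4
      have h7 : C'⁻¹ * (C'⁻¹ * ⟪gramian b m q s y, y⟫_ℝ) ≤ C'⁻¹ * ‖y‖ ^ 2 := by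
        calc _ ≤ C'⁻¹ * (C'⁻¹ * (C' * ‖y‖ ^ 2)) := by gcongr
          _ = C'⁻¹ * ‖y‖ ^ 2 := by field_simp
      have h8 : C'⁻¹ * ‖y‖ ^ 2 ≤ ⟪y, w⟫_ℝ := by linarith
      rwa [inv_mul_le_iff₀ hC'] at h8
    have hV0 : 0 ≤ ⟪y, w⟫_ℝ := by
      have h2 := hlow w
      rw [hy] at h2
      exact le_trans (by positivity) h2
    refine abs_le_of_sq_le_sq' ?_ (by positivity) |>.2
    calc ‖y‖ ^ 2 ≤ C' * ⟪y, w⟫_ℝ := h1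
      _ ≤ K * (s ^ (6 * n) * z ^ 2) := by gcongr
      _ ≤ K ^ 2 * (s ^ (6 * n) * z ^ 2) := by
          gcongr
          exact le_self_pow₀ hK (by norm_num)
      _ = _ := by ring
  · have h1 : ‖adjoint (q 0 s) w‖ ≤ C * ‖w‖ :=
      (ContinuousLinearMap.le_opNorm _ _).trans (by
        rw [LinearIsometryEquiv.norm_map]
        exact mul_le_mul_of_nonneg_right hq (norm_nonneg _))
    rw [norm_smul]
    calc ‖-(1 / 2 : ℝ)‖ * ‖adjoint (q 0 s) w‖ ≤ 1 * (C * (K * (s ^ (2 * n) * z))) := by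
          gcongr
          · rw [norm_neg]; norm_num
          · exact h1.trans (by gcongr)
      _ = _ := by ring

end Feedback

/-! ### Decay of the closed system under disturbances -/

section ClosedLoop

variable {V U : Type*} [NormedAddCommGroup V] [InnerProductSpace ℝ V] [CompleteSpace V]
  [NormedAddCommGroup U] [InnerProductSpace ℝ U] [CompleteSpace U]

open ContinuousLinearMap (adjoint)

/-- The field `s (P y + q₀ M y + R)`, `s = e^{-τ}`, of a system which is closed with the feedback
`M = gramFeedback` and disturbed by `R`. -/
noncomputable def closedField (b m : ℕ) (P : ℝ → V →L[ℝ] V) (q : ℕ → ℝ → U →L[ℝ] V)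
    (R : ℝ → V → V) (τ : ℝ) (y : V) : V :=
  Real.exp (-τ) • (P (Real.exp (-τ)) y + q 0 (Real.exp (-τ)) (gramFeedback b m q τ y) + R τ y)

/-- The energy identity of the closed system: the feedback contributes exactly the term that
cancels `‖q₀* w‖²` in the Lyapunov equation of the Gramian. -/
lemma energy_derivative {b m : ℕ} {P : ℝ → V →L[ℝ] V} {q : ℕ → ℝ → U →L[ℝ] V}
    {D : V →L[ℝ] V} {s T : ℝ} {y w v ρ : V} (hy : gramian b m q s w = y)
    (hD : s * ⟪D w, w⟫_ℝ = -2 * s * ⟪P s (gramian b m q s w), w⟫_ℝ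
        + s * ‖adjoint (q 0 s) w‖ ^ 2 - b * ⟪gramian b m q s w, w⟫_ℝ + 2 * s * T)
    (hv : v = s • (P s y + q 0 s (-(1 / 2 : ℝ) • adjoint (q 0 s) w) + ρ)) :
    2 * ⟪v, w⟫_ℝ + s * ⟪D w, w⟫_ℝ = -b * ⟪y, w⟫_ℝ + 2 * s * ⟪ρ, w⟫_ℝ + 2 * s * T := by
  rw [hD, hy, hv, real_inner_smul_left, inner_add_left, inner_add_left, map_smul,
    real_inner_smul_left, ← ContinuousLinearMap.adjoint_inner_right (q 0 s),
    real_inner_self_eq_norm_sq]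
  ring

/-- The scalar inequality behind the trapping region, where `s^{6n} z²` is the energy. -/
lemma trapping_inequality {n : ℕ} {s z K CR δ C' i T a d w r μ : ℝ}
    (hn : 1 ≤ n) (hs : s ∈ Ioc (0 : ℝ) 1) (hz : 0 < z) (hz1 : z ≤ 1) (hCR : 0 ≤ CR)
    (hK : 0 ≤ K) (hC' : 0 ≤ C') (hδ : 0 ≤ δ) (hδz : K * δ < z)
    (ha0 : 0 ≤ a) (hd0 : 0 ≤ d) (hw0 : 0 ≤ w)
    (ha : a ≤ K * (s ^ (3 * n) * z)) (hd : d ≤ K * (s ^ (2 * n) * z))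
    (hw : w ≤ K * (s ^ (2 * n) * z))
    (hr : r ≤ CR * ((a + d) ^ 2 + s ^ n * a + s ^ (2 * n) * d) + δ * s ^ (4 * n - 1))
    (hi : |i| ≤ r * w) (hT : |T| ≤ C' * s ^ (2 * n) * w ^ 2)
    (hμ : μ = 2 * C' * K ^ 2 + 2 * K * (CR * (4 * K ^ 2 + 2 * K))) :
    (6 * n - μ * s) * (s ^ (6 * n) * z ^ 2) +
      (-(6 * n + 2) * (s ^ (6 * n) * z ^ 2) + 2 * s * i + 2 * s * T) < 0 := by
  have hs0 := hs.1
  have hs1 := hs.2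
  have hp : ∀ k, 0 < s ^ k := fun k => pow_pos hs0 k
  have ha' : a ≤ K * (s ^ (2 * n) * z) := ha.trans <|
    mul_le_mul_of_nonneg_left (mul_le_mul_of_nonneg_right
      (pow_le_pow_of_le_one hs0.le hs1 (by omega)) hz.le) hK
  have hr' : r ≤ CR * (4 * K ^ 2 + 2 * K) * (s ^ (4 * n) * z) + δ * s ^ (4 * n - 1) := by
    have h1 : (a + d) ^ 2 ≤ 4 * K ^ 2 * (s ^ (4 * n) * z) := by
      calc (a + d) ^ 2 ≤ (K * (s ^ (2 * n) * z) + K * (s ^ (2 * n) * z)) ^ 2 := by gcongr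
        _ = 4 * K ^ 2 * (s ^ (4 * n) * (z * z)) := by ring
        _ ≤ 4 * K ^ 2 * (s ^ (4 * n) * (z * 1)) := by gcongr
        _ = _ := by ring
    have h2 : s ^ n * a ≤ K * (s ^ (4 * n) * z) := by
      calc s ^ n * a ≤ s ^ n * (K * (s ^ (3 * n) * z)) := by gcongr
        _ = _ := by ring
    have h3 : s ^ (2 * n) * d ≤ K * (s ^ (4 * n) * z) := by
      calc s ^ (2 * n) * d ≤ s ^ (2 * n) * (K * (s ^ (2 * n) * z)) := by gcongr
        _ = _ := by ring
    calc r ≤ CR * ((a + d) ^ 2 + s ^ n * a + s ^ (2 * n) * d) + δ * s ^ (4 * n - 1) := hr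
      _ ≤ CR * (4 * K ^ 2 * (s ^ (4 * n) * z) + K * (s ^ (4 * n) * z) + K * (s ^ (4 * n) * z))
          + δ * s ^ (4 * n - 1) := by gcongr
      _ = _ := by ring
  have hsi : s * i ≤ K * (CR * (4 * K ^ 2 + 2 * K)) * s * (s ^ (6 * n) * z ^ 2)
      + K * δ * (s ^ (6 * n) * z) := by
    have hsucc : s ^ (4 * n) = s ^ (4 * n - 1) * s := by
      rw [← pow_succ]; congr 1; omega
    calc s * i ≤ s * (r * w) := by
          gcongr
          exact (le_abs_self i).trans hi
      _ ≤ s * ((CR * (4 * K ^ 2 + 2 * K) * (s ^ (4 * n) * z) + δ * s ^ (4 * n - 1)) *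
          (K * (s ^ (2 * n) * z))) := by gcongr
      _ = K * (CR * (4 * K ^ 2 + 2 * K)) * s * (s ^ (4 * n) * s ^ (2 * n) * z ^ 2)
          + K * δ * ((s ^ (4 * n - 1) * s) * s ^ (2 * n) * z) := by ring
      _ = _ := by rw [← hsucc, ← pow_add]; ring_nf
  have hsT : s * T ≤ C' * K ^ 2 * s * (s ^ (6 * n) * z ^ 2) := by
    calc s * T ≤ s * (C' * s ^ (2 * n) * w ^ 2) := by
          gcongr
          exact (le_abs_self T).trans hT
      _ ≤ s * (C' * s ^ (2 * n) * (K * (s ^ (2 * n) * z)) ^ 2) := by gcongr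
      _ = _ := by ring
  have hneg : s ^ (6 * n) * z * (K * δ) < s ^ (6 * n) * z * z :=
    mul_lt_mul_of_pos_left hδz (mul_pos (hp _) hz)
  subst hμ
  nlinarith

lemma hasDerivAt_weight (n : ℕ) (μ τ : ℝ) :
    HasDerivAt (fun t : ℝ => Real.exp (6 * n * t + μ * Real.exp (-t)))
      (Real.exp (6 * n * τ + μ * Real.exp (-τ)) * (6 * n - μ * Real.exp (-τ))) τ := by
  have h1 : HasDerivAt (fun t : ℝ => Real.exp (-t)) (-Real.exp (-τ)) τ := by
    simpa using (hasDerivAt_neg τ).exp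
  have h2 := (((hasDerivAt_id τ).const_mul (6 * n : ℝ)).add (h1.const_mul μ)).exp
  convert! h2 using 1
  simp
  ring_nf

lemma exists_energy_scale {μ s e : ℝ} (hμ : 0 ≤ μ) (hs : s ∈ Ioc (0 : ℝ) 1) (he : 0 < e) :
    ∃ z : ℝ, 0 < z ∧ z ^ 2 = Real.exp (-(μ * s)) * e ^ 2 ∧ z ≤ e ∧ Real.exp (-μ) * e ≤ z := by
  have hz2 : Real.sqrt (Real.exp (-(μ * s)) * e ^ 2) ^ 2 = Real.exp (-(μ * s)) * e ^ 2 :=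
    Real.sq_sqrt (by positivity)
  have hz0 : 0 < Real.sqrt (Real.exp (-(μ * s)) * e ^ 2) := Real.sqrt_pos.2 (by positivity)
  have hμs : 0 ≤ μ * s := mul_nonneg hμ hs.1.le
  have hμs' : μ * s ≤ μ := mul_le_of_le_one_right hμ hs.2
  refine ⟨_, hz0, hz2, ?_, ?_⟩
  · refine abs_le_of_sq_le_sq' ?_ he.le |>.2
    rw [hz2]
    exact mul_le_of_le_one_left (sq_nonneg e) (Real.exp_le_one_iff.2 (by linarith))
  · refine abs_le_of_sq_le_sq' ?_ hz0.le |>.2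
    rw [hz2, mul_pow, ← Real.exp_nat_mul]
    gcongr
    push_cast
    linarith

variable (V U) in
/-- The Gramian feedback stabilizes the linear system and the perturbed system at once: if the
disturbance `R` is small of the orders `s^n ‖y‖`, `s^{2n} ‖d‖`, `(‖y‖ + ‖d‖)²` and `s^{4n-1}`, then
the energy weighted by `s^{-6n}` stays bounded, so that the state decays like `s^{3n}` and the
control like `s^{2n}`. -/
theorem exists_decaying_solution [FiniteDimensional ℝ U] {n m : ℕ} (hn : 1 ≤ n)
    (hm : m + 1 = 2 * n) {C κ CR : ℝ} (hC : 0 ≤ C) (hκ : 0 < κ) (hCR : 0 ≤ CR) :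
    ∃ K : ℝ, 1 ≤ K ∧ ∀ (P : ℝ → V →L[ℝ] V) (q : ℕ → ℝ → U →L[ℝ] V), ChainBounds n C κ P q →
      (∀ s ∈ Ioc (0 : ℝ) 1, IsUnit (gramian (6 * n + 2) (m + 1) q s)) ∧
      ∀ (R : ℝ → V → V) (e δ : ℝ), 0 < e → e ≤ 1 → 0 ≤ δ → K * δ < e →
      (∀ τ ∈ Ici (0 : ℝ), ∀ y, ‖y‖ ≤ K * e → ‖gramFeedback (6 * n + 2) (m + 1) q τ y‖ ≤ K * e →
        ‖R τ y‖ ≤ CR * ((‖y‖ + ‖gramFeedback (6 * n + 2) (m + 1) q τ y‖) ^ 2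
          + Real.exp (-τ) ^ n * ‖y‖
          + Real.exp (-τ) ^ (2 * n) * ‖gramFeedback (6 * n + 2) (m + 1) q τ y‖)
          + δ * Real.exp (-τ) ^ (4 * n - 1)) →
      IsLocLipField (closedField (6 * n + 2) (m + 1) P q R) → ∀ y₀, K * ‖y₀‖ ≤ e →
      ∃ y : ℝ → V, y 0 = y₀ ∧
        (∀ τ ∈ Ici (0 : ℝ),
          HasDerivWithinAt y (closedField (6 * n + 2) (m + 1) P q R τ (y τ)) (Ici 0) τ) ∧
        ∀ τ ∈ Ici (0 : ℝ), ‖y τ‖ ≤ K * e * Real.exp (-τ) ^ (3 * n) ∧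
          ‖gramFeedback (6 * n + 2) (m + 1) q τ (y τ)‖ ≤ K * e * Real.exp (-τ) ^ (2 * n) := by
  set b : ℕ := 6 * n + 2 with hb
  obtain ⟨c, C', hc, hC', hbounds⟩ := exists_gramian_bounds V U b hm hκ (C := C)
  -- `K₁` is the constant of the a priori estimates, `μ` the rate of the correction `exp (μ s)`
  -- which absorbs all terms that are integrable in `τ`
  obtain ⟨K₁, hK₁1, hK₁c, hK₁C'⟩ : ∃ K₁ : ℝ, 1 ≤ K₁ ∧ 1 ≤ K₁ * c ∧ C' ≤ K₁ := by
    refine ⟨max (max 1 c⁻¹) C', (le_max_left _ _).trans (le_max_left _ _), ?_, le_max_right _ _⟩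
    rw [← div_le_iff₀ hc, one_div]
    exact (le_max_right _ _).trans (le_max_left _ _)
  have hK₁0 : 0 < K₁ := by linarith
  set K₂ : ℝ := (1 + C) * K₁ with hK₂
  have hK₁₂ : K₁ ≤ K₂ := by rw [hK₂]; nlinarith
  have hCK₂ : C * K₁ ≤ K₂ := by rw [hK₂]; nlinarith
  set μ : ℝ := 2 * C' * K₂ ^ 2 + 2 * K₂ * (CR * (4 * K₂ ^ 2 + 2 * K₂)) with hμ
  have hK₂1 : 1 ≤ K₂ := hK₁1.trans hK₁₂
  have hK₂0 : 0 < K₂ := by linarith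
  have hμ0 : 0 ≤ μ := by positivity
  have hexpμ : 1 ≤ Real.exp μ := Real.one_le_exp hμ0
  set K : ℝ := Real.exp μ * K₂ with hK
  have hK₂K : K₂ ≤ K := by rw [hK]; nlinarith
  have hKone : 1 ≤ K := hK₂1.trans hK₂K
  refine ⟨K, hKone, fun P q hq => ⟨fun s hs =>
    isUnit_gramian hc hs.1 fun w => (hbounds P q hq s hs w).1, ?_⟩⟩
  intro R e δ he he1 hδ hδe hR hX y₀ hy₀
  have hs : ∀ τ ∈ Ici (0 : ℝ), Real.exp (-τ) ∈ Ioc (0 : ℝ) 1 := fun τ hτ =>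
    ⟨Real.exp_pos _, Real.exp_le_one_iff.2 (neg_nonpos.2 hτ)⟩
  let w : ℝ → V → V := fun τ x => Ring.inverse (gramian b (m + 1) q (Real.exp (-τ))) x
  have hWw : ∀ τ ∈ Ici (0 : ℝ), ∀ x, gramian b (m + 1) q (Real.exp (-τ)) (w τ x) = x := by
    intro τ hτ x
    have hu := isUnit_gramian hc (hs τ hτ).1 fun w => (hbounds P q hq _ (hs τ hτ) w).1
    have := congrArg (fun T : V →L[ℝ] V => T x) (Ring.mul_inverse_cancel _ hu)
    simpa using this
  have hM : ∀ τ x, gramFeedback b (m + 1) q τ x =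
      -(1 / 2 : ℝ) • adjoint (q 0 (Real.exp (-τ))) (w τ x) := fun τ x => by
    simp [gramFeedback, w]
  have hest : ∀ τ ∈ Ici (0 : ℝ), ∀ x z, 0 ≤ z →
      ⟪x, w τ x⟫_ℝ ≤ Real.exp (-τ) ^ (6 * n) * z ^ 2 →
      ‖w τ x‖ ≤ K₂ * (Real.exp (-τ) ^ (2 * n) * z) ∧ ‖x‖ ≤ K₂ * (Real.exp (-τ) ^ (3 * n) * z) ∧
      ‖gramFeedback b (m + 1) q τ x‖ ≤ K₂ * (Real.exp (-τ) ^ (2 * n) * z) := by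
    intro τ hτ x z hz hV
    have hs0 := (hs τ hτ).1
    obtain ⟨h1, h2, h3⟩ := energy_bounds hc hC' hC (hs τ hτ) hz hK₁1 hK₁c hK₁C'
      (fun w => (hbounds P q hq _ (hs τ hτ) w).1) (fun w => (hbounds P q hq _ (hs τ hτ) w).2.1)
      (hq.norm_le 0 (Nat.zero_le _) _ ⟨hs0.le, (hs τ hτ).2⟩) (hWw τ hτ x) hV
    rw [← hM] at h3
    exact ⟨h1.trans (by gcongr), h2.trans (by gcongr), h3.trans (by gcongr)⟩
  let E : ℝ → V → ℝ := fun τ x => Real.exp (6 * n * τ + μ * Real.exp (-τ)) * ⟪x, w τ x⟫_ℝ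
  have hscale : ∀ τ : ℝ, Real.exp (-τ) ^ (6 * n) * Real.exp (6 * n * τ) = 1 := by
    intro τ
    rw [← Real.exp_nat_mul, ← Real.exp_add]
    push_cast
    ring_nf
    exact Real.exp_zero
  have hV0 : ∀ τ ∈ Ici (0 : ℝ), ∀ x, 0 ≤ ⟪x, w τ x⟫_ℝ := by
    intro τ hτ x
    have h1 := (hbounds P q hq _ (hs τ hτ) (w τ x)).1
    rw [hWw τ hτ] at h1
    have hs0 := (hs τ hτ).1
    exact le_trans (by positivity) h1
  have hEV : ∀ τ ∈ Ici (0 : ℝ), ∀ x, ⟪x, w τ x⟫_ℝ =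
      Real.exp (-τ) ^ (6 * n) * (Real.exp (-(μ * Real.exp (-τ))) * E τ x) := by
    intro τ hτ x
    have h1 := hscale τ
    have h2 : Real.exp (-(μ * Real.exp (-τ))) * Real.exp (μ * Real.exp (-τ)) = 1 := by
      rw [← Real.exp_add, neg_add_cancel, Real.exp_zero]
    simp only [E, Real.exp_add]
    calc ⟪x, w τ x⟫_ℝ = (Real.exp (-τ) ^ (6 * n) * Real.exp (6 * n * τ)) *
          (Real.exp (-(μ * Real.exp (-τ))) * Real.exp (μ * Real.exp (-τ))) * ⟪x, w τ x⟫_ℝ := by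
          rw [h1, h2]; ring
      _ = _ := by ring
  have hEtrap : ∀ τ ∈ Ici (0 : ℝ), ∀ x, E τ x ≤ e ^ 2 →
      ‖x‖ ≤ K * e * Real.exp (-τ) ^ (3 * n) ∧
      ‖gramFeedback b (m + 1) q τ x‖ ≤ K * e * Real.exp (-τ) ^ (2 * n) := by
    intro τ hτ x hE
    have hs0 := (hs τ hτ).1
    have h1 : ⟪x, w τ x⟫_ℝ ≤ Real.exp (-τ) ^ (6 * n) * e ^ 2 := by
      rw [hEV τ hτ]
      gcongr
      calc _ ≤ Real.exp (-(μ * Real.exp (-τ))) * e ^ 2 := by gcongr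
        _ ≤ 1 * e ^ 2 := by
            gcongr
            exact Real.exp_le_one_iff.2 (by nlinarith)
        _ = e ^ 2 := one_mul _
    obtain ⟨-, h2, h3⟩ := hest τ hτ x e he.le h1
    constructor
    · calc ‖x‖ ≤ K₂ * (Real.exp (-τ) ^ (3 * n) * e) := h2
        _ ≤ K * (Real.exp (-τ) ^ (3 * n) * e) := by gcongr
        _ = _ := by ring
    · calc _ ≤ K₂ * (Real.exp (-τ) ^ (2 * n) * e) := h3
        _ ≤ K * (Real.exp (-τ) ^ (2 * n) * e) := by gcongr
        _ = _ := by ring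
  suffices h : _ ∧ _ ∧ _ by
    obtain ⟨y, hy0, hy, hyE⟩ := hX.exists_trapped_solution y₀ E (e ^ 2) h.1 h.2.1 h.2.2
    exact ⟨y, hy0, hy, fun τ hτ => hEtrap τ hτ _ (hyE τ hτ)⟩
  refine ⟨?_, ?_, ?_⟩
  · -- the initial energy
    have h00 : (0 : ℝ) ∈ Ici 0 := mem_Ici.2 le_rfl
    have h1 := (hbounds P q hq _ (hs 0 h00) (w 0 y₀)).1
    rw [hWw 0 h00] at h1
    have hs1 : Real.exp (-(0 : ℝ)) = 1 := by simp
    have h2 := real_inner_le_norm y₀ (w 0 y₀)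
    have h3 : ‖w 0 y₀‖ ≤ K₁ * ‖y₀‖ := by
      rcases (norm_nonneg (w 0 y₀)).eq_or_lt with h0 | h0
      · rw [← h0]; positivity
      · rw [hs1, one_pow, mul_one] at h1
        have h4 : c * ‖w 0 y₀‖ ≤ ‖y₀‖ := by
          refine le_of_mul_le_mul_right ?_ h0
          nlinarith
        calc ‖w 0 y₀‖ = 1 * ‖w 0 y₀‖ := (one_mul _).symm
          _ ≤ K₁ * c * ‖w 0 y₀‖ := by gcongr
          _ = K₁ * (c * ‖w 0 y₀‖) := by ring
          _ ≤ _ := by gcongr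
    have h5 : E 0 y₀ ≤ Real.exp μ * (‖y₀‖ * (K₁ * ‖y₀‖)) := by
      simp only [E, mul_zero, neg_zero, Real.exp_zero, mul_one, zero_add]
      gcongr
      exact h2.trans (by gcongr)
    calc E 0 y₀ ≤ Real.exp μ * (‖y₀‖ * (K₁ * ‖y₀‖)) := h5
      _ ≤ Real.exp μ * (‖y₀‖ * (K₂ * ‖y₀‖)) := by gcongr
      _ = K * ‖y₀‖ ^ 2 := by rw [hK]; ring
      _ ≤ K ^ 2 * ‖y₀‖ ^ 2 := by
          gcongr
          exact le_self_pow₀ hKone (by norm_num)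
      _ = (K * ‖y₀‖) ^ 2 := by ring
      _ ≤ e ^ 2 := by gcongr
  · intro T
    refine ⟨K * e, fun τ hτ x hx => (hEtrap τ hτ.1 x hx).1.trans ?_⟩
    exact mul_le_of_le_one_right (by positivity)
      (pow_le_one₀ (Real.exp_pos _).le (hs τ hτ.1).2)
  · intro τ hτ y v S hyv
    have hsτ := hs τ hτ
    obtain ⟨D, hD, hDw⟩ := exists_hasDerivAt_gramian b m hq.hasDerivAt (Real.exp (-τ))
    have hu := isUnit_gramian hc hsτ.1 fun w => (hbounds P q hq _ hsτ w).1
    have hen := hasDerivWithinAt_energy hD hu (inner_gramian_comm _ _ _ _) hyv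
    have hfac := hasDerivAt_weight n μ τ
    refine ⟨_, hfac.hasDerivWithinAt.mul hen, fun hE hv => ?_⟩
    set x := y τ with hx
    set s := Real.exp (-τ) with hsdef
    have hs0 := hsτ.1
    have hVE := hEV τ hτ x
    rw [hE] at hVE
    -- `z` is the energy in the natural scale: `⟪x, W⁻¹ x⟫ = s^{6n} z²`
    obtain ⟨z, hz0, hz2, hze, hez⟩ := exists_energy_scale hμ0 hsτ he
    have hδz : K₂ * δ < z := by
      refine lt_of_lt_of_le ?_ hez
      have h1 : Real.exp (-μ) * (K * δ) < Real.exp (-μ) * e :=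
        mul_lt_mul_of_pos_left hδe (Real.exp_pos _)
      have h2 : Real.exp (-μ) * (K * δ) = K₂ * δ := by
        rw [hK, ← mul_assoc, ← mul_assoc, ← Real.exp_add, neg_add_cancel, Real.exp_zero, one_mul]
      rwa [h2] at h1
    rw [← hz2] at hVE
    obtain ⟨hw', hx', hd'⟩ := hest τ hτ x z hz0.le hVE.le
    have hsmall := hEtrap τ hτ x hE.le
    have hKe : 0 ≤ K * e := by positivity
    have hRx := hR τ hτ x
      (hsmall.1.trans (mul_le_of_le_one_right hKe (pow_le_one₀ hs0.le hsτ.2)))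
      (hsmall.2.trans (mul_le_of_le_one_right hKe (pow_le_one₀ hs0.le hsτ.2)))
    have hderiv := energy_derivative (hWw τ hτ x) (hDw (w τ x))
      (v := v) (ρ := R τ x) (by rw [hv, closedField, hM])
    have htrap := trapping_inequality hn hsτ hz0 (hze.trans he1) hCR hK₂0.le hC'.le hδ hδz
      (norm_nonneg x) (norm_nonneg _) (norm_nonneg _) hx' hd' hw' hRx
      (abs_real_inner_le_norm (R τ x) (w τ x)) (hbounds P q hq s hsτ (w τ x)).2.2 hμ
    rw [← hVE] at htrap
    have hbR : (b : ℝ) = 6 * n + 2 := by rw [hb]; push_cast; ring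
    rw [hbR] at hderiv
    change Real.exp (6 * n * τ + μ * s) * (6 * n - μ * s) * ⟪x, w τ x⟫_ℝ +
      Real.exp (6 * n * τ + μ * s) * (2 * ⟪v, w τ x⟫_ℝ + s * ⟪D (w τ x), w τ x⟫_ℝ) < 0
    rw [hderiv, mul_assoc, ← mul_add]
    exact mul_neg_of_pos_of_neg (Real.exp_pos _) htrap

end ClosedLoop

/-! ### Chains of brackets and the rank condition -/

section Chain

variable {V U E : Type*} [NormedAddCommGroup V] [NormedSpace ℝ V] [NormedAddCommGroup U]
  [NormedSpace ℝ U] [NormedAddCommGroup E] [NormedSpace ℝ E]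

/-- The brackets `q₀ = Q`, `q_{k+1} = P q_k + ∂q_k/∂s` of a linear control system which depends on
a parameter `p` and on `s`; the argument is the pair `(p, s)`. -/
noncomputable def chain (P : E × ℝ → V →L[ℝ] V) (Q : E × ℝ → U →L[ℝ] V) : ℕ → E × ℝ → U →L[ℝ] V
  | 0 => Q
  | k + 1 => fun z => (P z).comp (chain P Q k z) + fderiv ℝ (chain P Q k) z (0, 1)

variable {P : E × ℝ → V →L[ℝ] V} {Q : E × ℝ → U →L[ℝ] V}

lemma contDiff_chain (hP : ContDiff ℝ ∞ P) (hQ : ContDiff ℝ ∞ Q) (k : ℕ) :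
    ContDiff ℝ ∞ (chain P Q k) := by
  induction k with
  | zero => exact hQ
  | succ k ih =>
    exact (hP.clm_comp ih).add ((ih.fderiv_right (m := ∞) (by simp)).clm_apply contDiff_const)

lemma _root_.DifferentiableAt.hasDerivAt_prodMk_left {F : Type*} [NormedAddCommGroup F]
    [NormedSpace ℝ F] {H : E × ℝ → F} {p : E} {s : ℝ} (h : DifferentiableAt ℝ H (p, s)) :
    HasDerivAt (fun t => H (p, t)) (fderiv ℝ H (p, s) (0, 1)) s :=
  h.hasFDerivAt.comp_hasDerivAt s ((hasDerivAt_const s p).prodMk (hasDerivAt_id s))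

lemma hasDerivAt_chain (hP : ContDiff ℝ ∞ P) (hQ : ContDiff ℝ ∞ Q) (p : E) (k : ℕ) (s : ℝ) :
    HasDerivAt (fun t => chain P Q k (p, t))
      (chain P Q (k + 1) (p, s) - (P (p, s)).comp (chain P Q k (p, s))) s := by
  rw [chain, add_sub_cancel_left]
  exact ((contDiff_chain hP hQ k).differentiable (by simp) _).hasDerivAt_prodMk_left

lemma chain_eq_of_const (hP : ContDiff ℝ ∞ P) (hQ : ContDiff ℝ ∞ Q) {p : E} {A : V →L[ℝ] V}
    {B : U →L[ℝ] V} (hA : ∀ s, P (p, s) = A) (hB : ∀ s, Q (p, s) = B) (k : ℕ) (s : ℝ) :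
    chain P Q k (p, s) = (A ^ k).comp B := by
  induction k generalizing s with
  | zero => exact (hB s).trans (by rw [pow_zero]; rfl)
  | succ k ih =>
    have h1 := hasDerivAt_chain hP hQ p k s
    simp only [ih] at h1
    have h2 := h1.unique (hasDerivAt_const s _)
    rw [sub_eq_zero] at h2
    rw [h2, hA, pow_succ']
    rfl

end Chain

section RankCondition

variable {V U E : Type*} [NormedAddCommGroup V] [InnerProductSpace ℝ V] [CompleteSpace V]
  [NormedAddCommGroup U] [InnerProductSpace ℝ U] [CompleteSpace U]
  [NormedAddCommGroup E] [NormedSpace ℝ E] {P : E × ℝ → V →L[ℝ] V} {Q : E × ℝ → U →L[ℝ] V}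

open ContinuousLinearMap (adjoint)

/-- Near a constant system `(A, B)` satisfying the rank condition, all systems have uniformly
bounded and uniformly spanning chains of brackets. -/
lemma eventually_chainBounds [FiniteDimensional ℝ V] {n : ℕ} (hn : 1 ≤ n) (hP : ContDiff ℝ ∞ P)
    (hQ : ContDiff ℝ ∞ Q) {p₀ : E} {A : V →L[ℝ] V} {B : U →L[ℝ] V}
    (hA : ∀ s, P (p₀, s) = A) (hB : ∀ s, Q (p₀, s) = B)
    (hrank : ∀ w, (∀ k < n, adjoint ((A ^ k).comp B) w = 0) → w = 0) :
    ∃ C κ : ℝ, 0 ≤ C ∧ 0 < κ ∧ ∀ᶠ p in 𝓝 p₀,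
      ChainBounds n C κ (fun s => P (p, s)) (fun k s => chain P Q k (p, s)) := by
  -- the constant system: injectivity of `w ↦ (B* w, B* A* w, …)` gives a lower bound
  let L : V →ₗ[ℝ] (Fin n → U) :=
    LinearMap.pi fun k : Fin n => (adjoint ((A ^ (k : ℕ)).comp B)).toLinearMap
  have hker : LinearMap.ker L = ⊥ := by
    rw [LinearMap.ker_eq_bot']
    intro w hw
    exact hrank w fun k hk => congrFun hw ⟨k, hk⟩
  obtain ⟨κ', hκ', hanti⟩ := L.exists_antilipschitzWith hker
  have hκ'0 : (0 : ℝ) < κ' := hκ'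
  have hnom : ∀ w, ∃ k < n, (κ' : ℝ)⁻¹ * ‖w‖ ≤ ‖adjoint ((A ^ k).comp B) w‖ := by
    intro w
    by_contra! hcon
    rcases (norm_nonneg w).eq_or_lt with h0 | h0
    · have h1 := hcon 0 (by omega)
      rw [← h0, mul_zero] at h1
      exact absurd h1 (not_lt.2 (norm_nonneg _))
    · have h1 : ‖L w‖ < (κ' : ℝ)⁻¹ * ‖w‖ := by
        rw [pi_norm_lt_iff (by positivity)]
        exact fun k => hcon k k.2
      have h2 := hanti.le_mul_dist w 0
      rw [map_zero, dist_zero_right, dist_zero_right] at h2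
      have h3 : (κ' : ℝ) * ‖L w‖ < κ' * ((κ' : ℝ)⁻¹ * ‖w‖) := by gcongr
      rw [← mul_assoc, mul_inv_cancel₀ hκ'0.ne', one_mul] at h3
      linarith
  set κ : ℝ := (κ' : ℝ)⁻¹ / 2 with hκ
  have hκ0 : 0 < κ := by positivity
  have hcont : ∀ k, Continuous (chain P Q k) := fun k => (contDiff_chain hP hQ k).continuous
  have hnomk := chain_eq_of_const hP hQ hA hB
  set C : ℝ := ∑ k ∈ Finset.range (2 * n + 1), ‖(A ^ k).comp B‖ + κ with hC
  have hclose : ∀ᶠ p in 𝓝 p₀, ∀ k ∈ Finset.range (2 * n + 1), ∀ s ∈ Icc (0 : ℝ) 1,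
      ‖chain P Q k (p, s) - (A ^ k).comp B‖ < κ := by
    rw [Filter.eventually_all_finset]
    intro k _
    refine isCompact_Icc.eventually_forall_of_forall_eventually fun s _ => ?_
    have h1 : Continuous fun z : E × ℝ => ‖chain P Q k z - (A ^ k).comp B‖ := by
      have := hcont k
      fun_prop
    refine h1.continuousAt.eventually_lt continuousAt_const ?_
    rw [hnomk, sub_self, norm_zero]
    exact hκ0
  refine ⟨C, κ, by positivity, hκ0, ?_⟩
  filter_upwards [hclose] with p hp
  refine ⟨fun k s => hasDerivAt_chain hP hQ p k s, fun k hk s hs => ?_, fun s hs w => ?_⟩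
  · have hk' : k ∈ Finset.range (2 * n + 1) := Finset.mem_range.2 (by omega)
    have h1 := hp k hk' s hs
    have h2 : ‖(A ^ k).comp B‖ ≤ ∑ k ∈ Finset.range (2 * n + 1), ‖(A ^ k).comp B‖ :=
      Finset.single_le_sum (f := fun k => ‖(A ^ k).comp B‖) (fun _ _ => norm_nonneg _) hk'
    have h3 := norm_le_norm_sub_add (chain P Q k (p, s)) ((A ^ k).comp B)
    linarith
  · obtain ⟨k, hk, hlow⟩ := hnom w
    refine ⟨k, hk, ?_⟩
    have h1 := hp k (Finset.mem_range.2 (by omega)) s hs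
    have h2 : ‖adjoint (chain P Q k (p, s) - (A ^ k).comp B) w‖ ≤ κ * ‖w‖ :=
      (ContinuousLinearMap.le_opNorm _ _).trans (by
        rw [LinearIsometryEquiv.norm_map]
        gcongr)
    rw [map_sub, sub_apply] at h2
    have h3 := norm_le_norm_sub_add (adjoint ((A ^ k).comp B) w) (adjoint (chain P Q k (p, s)) w)
    rw [norm_sub_rev] at h3
    have h4 : (κ' : ℝ)⁻¹ * ‖w‖ = κ * ‖w‖ + κ * ‖w‖ := by rw [hκ]; ring
    linarith

end RankCondition

/-! ### Taylor expansions of families of paths -/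

section Taylor

variable {E F : Type*} [NormedAddCommGroup E] [NormedSpace ℝ E]
  [NormedAddCommGroup F] [NormedSpace ℝ F]

/-- The derivatives with respect to `s` of a function which is smooth in `(p, s)` are jointly
continuous. -/
lemma continuous_iteratedDeriv_of_contDiff {k m : ℕ} (hkm : k ≤ m) {H : E × ℝ → F}
    (hH : ContDiff ℝ m H) :
    Continuous fun z : E × ℝ => iteratedDeriv k (fun s => H (z.1, s)) z.2 := by
  induction k generalizing m H with
  | zero => simpa using hH.continuous
  | succ k ih =>
    obtain ⟨m, rfl⟩ : ∃ l, m = l + 1 := ⟨m - 1, by omega⟩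
    have h1 : ContDiff ℝ m fun z : E × ℝ => fderiv ℝ H z (0, 1) :=
      (hH.fderiv_right (m := m) (by push_cast; exact le_rfl)).clm_apply contDiff_const
    have h2 : ∀ p : E, deriv (fun s => H (p, s)) = fun s => fderiv ℝ H (p, s) (0, 1) := fun p =>
      funext fun s => (hH.differentiable (by simp) _).hasDerivAt_prodMk_left.deriv
    simp only [iteratedDeriv_succ', h2]
    exact ih (by omega) h1

/-- Taylor's formula on `[0,1]` at the point `0`. -/
lemma norm_sub_taylor_le {h : ℝ → F} {N : ℕ} (hh : ContDiff ℝ N h) {C : ℝ}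
    (hC : ∀ s ∈ Icc (0 : ℝ) 1, ‖iteratedDeriv N h s‖ ≤ C) {s : ℝ} (hs : s ∈ Icc (0 : ℝ) 1) :
    ‖h s - ∑ i ∈ Finset.range N, s ^ i • ((1 / (i.factorial : ℝ)) • iteratedDeriv i h 0)‖ ≤
      C * s ^ N := by
  rcases N with _ | N
  · simpa using hC s hs
  · have hU : UniqueDiffOn ℝ (Icc (0 : ℝ) 1) := uniqueDiffOn_Icc zero_lt_one
    have hW : ∀ k ≤ N + 1, ∀ t ∈ Icc (0 : ℝ) 1,
        iteratedDerivWithin k h (Icc 0 1) t = iteratedDeriv k h t := fun k hk t ht =>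
      iteratedDerivWithin_eq_iteratedDeriv hU
        ((hh.of_le (by exact_mod_cast hk)).contDiffAt) ht
    have h1 := taylor_mean_remainder_bound (n := N) zero_le_one
      (by exact_mod_cast hh.contDiffOn) hs
      (fun t ht => by rw [hW _ le_rfl t ht]; exact hC t ht)
    have h2 : taylorWithinEval h N (Icc 0 1) 0 s = ∑ i ∈ Finset.range (N + 1),
        s ^ i • ((1 / (i.factorial : ℝ)) • iteratedDeriv i h 0) := by
      rw [taylor_within_apply]
      refine Finset.sum_congr rfl fun i hi => ?_
      rw [hW i (by have := Finset.mem_range.1 hi; omega) 0 ⟨le_rfl, zero_le_one⟩, smul_smul,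
        sub_zero, one_div, mul_comm]
    rw [h2, sub_zero] at h1
    refine h1.trans (div_le_self ?_ (by exact_mod_cast N.factorial_pos))
    exact mul_nonneg ((norm_nonneg _).trans (hC s hs)) (pow_nonneg hs.1 _)

lemma taylor_isBigO {h : ℝ → F} {N : ℕ} (hh : ContDiff ℝ N h) :
    (fun s => h s - ∑ i ∈ Finset.range N, s ^ i • ((1 / (i.factorial : ℝ)) • iteratedDeriv i h 0))
      =O[𝓝[>] (0 : ℝ)] fun s => s ^ N := by
  obtain ⟨C, hC⟩ := isCompact_Icc.exists_bound_of_continuousOn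
    ((hh.continuous_iteratedDeriv N le_rfl).continuousOn (s := Icc (0 : ℝ) 1))
  refine IsBigO.of_bound C ?_
  filter_upwards [Ioc_mem_nhdsGT zero_lt_one] with s hs
  rw [Real.norm_of_nonneg (pow_nonneg hs.1.le N)]
  exact norm_sub_taylor_le hh hC ⟨hs.1.le, hs.2⟩

/-- A polynomial of degree less than `N` which is `O(s^N)` at `0` vanishes. -/
lemma eq_zero_of_sum_pow_isBigO {N : ℕ} {c : ℕ → F}
    (h : (fun s : ℝ => ∑ i ∈ Finset.range N, s ^ i • c i) =O[𝓝[>] (0 : ℝ)] fun s => s ^ N) :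
    ∀ i < N, c i = 0 := by
  induction N generalizing c with
  | zero => intro i hi; omega
  | succ N ih =>
    have hcont : Continuous fun s : ℝ => ∑ i ∈ Finset.range (N + 1), s ^ i • c i := by fun_prop
    have hlim : Tendsto (fun s : ℝ => ∑ i ∈ Finset.range (N + 1), s ^ i • c i) (𝓝[>] 0)
        (𝓝 (c 0)) := by
      have h1 := (hcont.tendsto 0).mono_left (nhdsWithin_le_nhds (s := Ioi 0))
      have h2 : ∑ i ∈ Finset.range (N + 1), (0 : ℝ) ^ i • c i = c 0 := by
        rw [Finset.sum_range_succ']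
        simp
      rwa [h2] at h1
    have hzero : Tendsto (fun s : ℝ => s ^ (N + 1)) (𝓝[>] 0) (𝓝 0) := by
      have h1 : Continuous fun s : ℝ => s ^ (N + 1) := by fun_prop
      simpa using (h1.tendsto 0).mono_left (nhdsWithin_le_nhds (s := Ioi 0))
    have hc0 : c 0 = 0 := tendsto_nhds_unique hlim (h.trans_tendsto hzero)
    have hrec : ∀ i < N, c (i + 1) = 0 := by
      refine ih (c := fun i => c (i + 1)) ?_
      obtain ⟨C, hC⟩ := h.bound
      refine IsBigO.of_bound C ?_
      filter_upwards [hC, self_mem_nhdsWithin] with s hs hs0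
      have hs0' : (0 : ℝ) < s := hs0
      have h1 : ∑ i ∈ Finset.range (N + 1), s ^ i • c i =
          s • ∑ i ∈ Finset.range N, s ^ i • c (i + 1) := by
        rw [Finset.sum_range_succ', hc0, smul_zero, add_zero, Finset.smul_sum]
        exact Finset.sum_congr rfl fun i _ => by rw [smul_smul, pow_succ']
      rw [h1, norm_smul, pow_succ', norm_mul] at hs
      have h2 : 0 < ‖s‖ := norm_pos_iff.2 hs0'.ne'
      refine le_of_mul_le_mul_left ?_ h2
      linarith
    intro i hi
    rcases i with _ | i
    · exact hc0
    · exact hrec i (by omega)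

/-- If a polynomial of degree less than `N` cancels `h` up to `O(s^N)`, it is minus the Taylor
polynomial of `h`. -/
lemma taylor_add_eq_zero_of_isBigO {h : ℝ → F} {N : ℕ} (hh : ContDiff ℝ N h) {c : ℕ → F}
    (hO : (fun s => h s + ∑ i ∈ Finset.range N, s ^ i • c i) =O[𝓝[>] (0 : ℝ)] fun s => s ^ N) :
    ∀ i < N, (1 / (i.factorial : ℝ)) • iteratedDeriv i h 0 + c i = 0 := by
  refine eq_zero_of_sum_pow_isBigO ((hO.sub (taylor_isBigO hh)).congr_left fun s => ?_)
  simp only [smul_add, Finset.sum_add_distrib]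
  abel

end Taylor

/-- A continuous family which vanishes for the parameter `p₀` is uniformly small on `[0,1]` for
the parameters near `p₀`. -/
lemma eventually_forall_Icc_norm_lt {X : Type*} [TopologicalSpace X] {p₀ : X}
    {F : Type*} [NormedAddCommGroup F] {G : X × ℝ → F}
    (hG : Continuous G) (h0 : ∀ s, G (p₀, s) = 0) {δ : ℝ} (hδ : 0 < δ) :
    ∀ᶠ p in 𝓝 p₀, ∀ s ∈ Icc (0 : ℝ) 1, ‖G (p, s)‖ < δ := by
  refine isCompact_Icc.eventually_forall_of_forall_eventually fun s _ => ?_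
  refine hG.norm.continuousAt.eventually_lt continuousAt_const ?_
  rw [h0, norm_zero]
  exact hδ

/-! ### The shifts -/

section Shift

variable {n r : ℕ}

/-- The vector `φ⁽ʲ⁺¹⁾` of the `(j+1)`-st shift. -/
noncomputable def shiftCoeff (g : Vec n × Vec r → Vec n) (xbar : Vec n) (j : ℕ) : Vec n :=
  -((1 : ℝ) / (j + 1)) • (((1 : ℝ) / (j.factorial : ℝ)) •
    iteratedDeriv j (fun σ : ℝ => g (xbar + shift g xbar j σ, 0)) 0)

lemma shift_succ (g : Vec n × Vec r → Vec n) (xbar : Vec n) (k : ℕ) (s : ℝ) :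
    shift g xbar (k + 1) s = shift g xbar k s + s ^ (k + 1) • shiftCoeff g xbar k := rfl

lemma shift_eq_sum (g : Vec n × Vec r → Vec n) (xbar : Vec n) (k : ℕ) (s : ℝ) :
    shift g xbar k s = ∑ j ∈ Finset.range k, s ^ (j + 1) • shiftCoeff g xbar j := by
  induction k with
  | zero => rfl
  | succ k ih => rw [shift_succ, ih, Finset.sum_range_succ]

lemma shift_zero_right (g : Vec n × Vec r → Vec n) (xbar : Vec n) (k : ℕ) :
    shift g xbar k 0 = 0 := by
  simp [shift_eq_sum]

lemma contDiff_shift (g : Vec n × Vec r → Vec n) (xbar : Vec n) (k : ℕ) {m : WithTop ℕ∞} :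
    ContDiff ℝ m (shift g xbar k) := by
  have : shift g xbar k = fun s => ∑ j ∈ Finset.range k, s ^ (j + 1) • shiftCoeff g xbar j :=
    funext fun s => shift_eq_sum g xbar k s
  rw [this]
  fun_prop

lemma hasDerivAt_shift (g : Vec n × Vec r → Vec n) (xbar : Vec n) (k : ℕ) (s : ℝ) :
    HasDerivAt (shift g xbar k)
      (∑ j ∈ Finset.range k, s ^ j • (((j : ℝ) + 1) • shiftCoeff g xbar j)) s := by
  have : shift g xbar k = fun s => ∑ j ∈ Finset.range k, s ^ (j + 1) • shiftCoeff g xbar j :=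
    funext fun s => shift_eq_sum g xbar k s
  rw [this]
  refine HasDerivAt.fun_sum fun j _ => ?_
  convert! (hasDerivAt_pow (j + 1) s).smul_const (shiftCoeff g xbar j) using 1
  rw [smul_smul, mul_comm, Nat.add_sub_cancel, Nat.cast_succ]

lemma shift_zero_param {f : Vec n × Vec r → Vec n} (hf0 : f (0, 0) = 0) (k : ℕ) (s : ℝ) :
    shift (perturbed f 0) 0 k s = 0 := by
  induction k generalizing s with
  | zero => rfl
  | succ k ih =>
    have h1 : (fun σ : ℝ => perturbed f 0 (0 + shift (perturbed f 0) 0 k σ, 0)) =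
        fun _ => (0 : Vec n) := by
      funext σ
      rw [ih, perturbed, add_zero, add_zero]
      exact hf0
    rw [shift_succ, ih, shiftCoeff, h1]
    simp

/-- The polynomial path `x̄ + ∑ s^{j+1} φ_j` as a function of its coefficients and of `s`. -/
lemma contDiff_polyPath (N : ℕ) {m : WithTop ℕ∞} :
    ContDiff ℝ m fun z : ((Vec n × Vec n) × (Fin N → Vec n)) × ℝ =>
      z.1.1.1 + ∑ j : Fin N, z.2 ^ ((j : ℕ) + 1) • z.1.2 j := by
  fun_prop

lemma continuous_iteratedDeriv_shift {f : Vec n × Vec r → Vec n} {Y : Type*}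
    [NormedAddCommGroup Y] [NormedSpace ℝ Y] {G : Vec n × Vec n → Y} {m k N : ℕ}
    (hG : ContDiff ℝ m G) (hk : k ≤ m)
    (hc : ∀ j < N, Continuous fun θ : Vec n × Vec n => shiftCoeff (perturbed f θ.2) θ.1 j) :
    Continuous fun z : (Vec n × Vec n) × ℝ =>
      iteratedDeriv k (fun s => G (z.1.1 + shift (perturbed f z.1.2) z.1.1 N s, z.1.2)) z.2 := by
  let H : ((Vec n × Vec n) × (Fin N → Vec n)) × ℝ → Y := fun z =>
    G (z.1.1.1 + ∑ j : Fin N, z.2 ^ ((j : ℕ) + 1) • z.1.2 j, z.1.1.2)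
  have hH : ContDiff ℝ m H :=
    hG.comp ((contDiff_polyPath N).prodMk (by fun_prop))
  have hcoef : Continuous fun z : (Vec n × Vec n) × ℝ =>
      (((z.1, fun j : Fin N => shiftCoeff (perturbed f z.1.2) z.1.1 j), z.2) :
        ((Vec n × Vec n) × (Fin N → Vec n)) × ℝ) := by
    refine Continuous.prodMk (continuous_fst.prodMk (continuous_pi fun j => ?_)) continuous_snd
    exact (hc j j.2).comp continuous_fst
  have h := (continuous_iteratedDeriv_of_contDiff hk hH).comp hcoef
  convert! h using 2 with z
  simp only [Function.comp, H]
  congr 1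
  funext s
  rw [shift_eq_sum, Finset.sum_range]

lemma continuous_shiftCoeff {f : Vec n × Vec r → Vec n} {m : ℕ} (hf : ContDiff ℝ m f) (j : ℕ)
    (hj : j ≤ m) :
    Continuous fun θ : Vec n × Vec n => shiftCoeff (perturbed f θ.2) θ.1 j := by
  induction j using Nat.strong_induction_on with
  | _ j ih =>
    have hG : ContDiff ℝ m fun p : Vec n × Vec n => f (p.1, 0) + p.2 := by fun_prop
    have h := continuous_iteratedDeriv_shift (f := f) hG hj fun i hi => ih i hi (by omega)
    have h2 := h.comp (Continuous.prodMk_left (0 : ℝ))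
    exact (h2.const_smul ((1 : ℝ) / (j.factorial : ℝ))).const_smul (-((1 : ℝ) / (j + 1)))

lemma continuous_shift {f : Vec n × Vec r → Vec n} {m : ℕ} (hf : ContDiff ℝ m f) {N : ℕ}
    (hN : N ≤ m + 1) :
    Continuous fun z : (Vec n × Vec n) × ℝ => shift (perturbed f z.1.2) z.1.1 N z.2 := by
  simp only [shift_eq_sum]
  refine continuous_finsetSum _ fun j hj => ?_
  have h1 := (continuous_shiftCoeff hf j (by have := Finset.mem_range.1 hj; omega)).comp
    (continuous_fst (X := Vec n × Vec n) (Y := ℝ))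
  exact (continuous_snd.pow _).smul h1

/-- Each shift cancels one more Taylor coefficient of the terms free of the state and the
control. -/
lemma residual_isBigO {f : Vec n × Vec r → Vec n} {m : ℕ} (hf : ContDiff ℝ m f) (hm : 1 ≤ m)
    (xbar F : Vec n) (k : ℕ) (hk : k ≤ m) :
    (fun s => perturbed f F (xbar + shift (perturbed f F) xbar k s, 0)
      + ∑ j ∈ Finset.range k, s ^ j • (((j : ℝ) + 1) • shiftCoeff (perturbed f F) xbar j))
      =O[𝓝[>] (0 : ℝ)] fun s => s ^ k := by
  set g := perturbed f F with hg
  have hgm : ContDiff ℝ m g := hf.add contDiff_const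
  have hh : ∀ k, ContDiff ℝ m fun s => g (xbar + shift g xbar k s, 0) := fun k =>
    hgm.comp ((contDiff_const.add (contDiff_shift g xbar k)).prodMk contDiff_const)
  induction k with
  | zero =>
    have h1 : Continuous fun s => g (xbar + shift g xbar 0 s, 0) := (hh 0).continuous
    have h2 := (h1.tendsto 0).mono_left (nhdsWithin_le_nhds (s := Ioi 0))
    simpa using h2.isBigO_one ℝ
  | succ k ih =>
    have hcoef := taylor_add_eq_zero_of_isBigO ((hh k).of_le (by exact_mod_cast (by omega : k ≤ m)))
      (ih (by omega))
    have hlast : (1 / (k.factorial : ℝ)) •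
        iteratedDeriv k (fun s => g (xbar + shift g xbar k s, 0)) 0
          + ((k : ℝ) + 1) • shiftCoeff g xbar k = 0 := by
      have h0 : (k : ℝ) + 1 ≠ 0 := by positivity
      rw [shiftCoeff, smul_smul, mul_neg, mul_one_div_cancel h0, neg_one_smul, add_neg_cancel]
    have hT := taylor_isBigO ((hh k).of_le (by exact_mod_cast hk : ((k + 1 : ℕ) : WithTop ℕ∞) ≤ m))
    have hT' : (fun s => g (xbar + shift g xbar k s, 0)
        + ∑ j ∈ Finset.range (k + 1), s ^ j • (((j : ℝ) + 1) • shiftCoeff g xbar j))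
        =O[𝓝[>] (0 : ℝ)] fun s => s ^ (k + 1) := by
      refine hT.congr_left fun s => ?_
      rw [sub_eq_add_neg, ← Finset.sum_neg_distrib]
      congr 1
      refine Finset.sum_congr rfl fun i hi => ?_
      rw [← smul_neg]
      congr 1
      rcases (Nat.lt_succ_iff_lt_or_eq.1 (Finset.mem_range.1 hi)) with h | rfl
      · exact neg_eq_of_add_eq_zero_right (hcoef i h)
      · exact neg_eq_of_add_eq_zero_right hlast
    have hdiff : (fun s => g (xbar + shift g xbar (k + 1) s, 0) - g (xbar + shift g xbar k s, 0))
        =O[𝓝[>] (0 : ℝ)] fun s => s ^ (k + 1) := by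
      have hstrict := (hgm.contDiffAt (x := (xbar, 0))).hasStrictFDerivAt
        (by exact_mod_cast (by omega : m ≠ 0))
      have hlim : ∀ j, Tendsto (fun s : ℝ => ((xbar + shift g xbar j s, 0) : Vec n × Vec r))
          (𝓝[>] 0) (𝓝 (xbar, 0)) := by
        intro j
        have h1 : Continuous fun s : ℝ => ((xbar + shift g xbar j s, 0) : Vec n × Vec r) :=
          (continuous_const.add (contDiff_shift (m := 0) g xbar j).continuous).prodMk
            continuous_const
        simpa [shift_zero_right] using (h1.tendsto 0).mono_left (nhdsWithin_le_nhds (s := Ioi 0))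
      have h2 := hstrict.isBigO_sub.comp_tendsto ((hlim (k + 1)).prodMk_nhds (hlim k))
      refine h2.trans (IsBigO.of_bound ‖shiftCoeff g xbar k‖ (Eventually.of_forall fun s => ?_))
      simp only [Function.comp, Prod.mk_sub_mk, shift_succ, sub_self]
      rw [show xbar + (shift g xbar k s + s ^ (k + 1) • shiftCoeff g xbar k)
        - (xbar + shift g xbar k s) = s ^ (k + 1) • shiftCoeff g xbar k by abel]
      rw [Prod.norm_def, norm_zero, max_eq_left (norm_nonneg _), norm_smul, mul_comm]
    refine (hT'.add hdiff).congr_left fun s => ?_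
    abel

end Shift

/-! ### The truncated linear part of the shifted system -/

section Linearization

variable {n r : ℕ}

/-- `∂f/∂x (x, 0)`. -/
noncomputable def partialX (f : Vec n × Vec r → Vec n) (x : Vec n) : Vec n →L[ℝ] Vec n :=
  fderiv ℝ (fun z : Vec n => f (z, 0)) x

/-- `∂f/∂u (x, 0)`. -/
noncomputable def partialU (f : Vec n × Vec r → Vec n) (x : Vec n) : Vec r →L[ℝ] Vec n :=
  fderiv ℝ (fun u : Vec r => f (x, u)) 0

lemma contDiff_partialX {f : Vec n × Vec r → Vec n} {m : ℕ} (hf : ContDiff ℝ (m + 1 : ℕ) f) :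
    ContDiff ℝ m (partialX f) :=
  ContDiff.fderiv_right (n := ((m + 1 : ℕ) : WithTop ℕ∞))
    (hf.comp (contDiff_id.prodMk contDiff_const)) (by push_cast; exact le_rfl)

lemma partialU_eq {f : Vec n × Vec r → Vec n} (hf : Differentiable ℝ f) (x : Vec n) :
    partialU f x = (fderiv ℝ f (x, 0)).comp (ContinuousLinearMap.inr ℝ (Vec n) (Vec r)) :=
  ((hf (x, 0)).hasFDerivAt.comp (0 : Vec r) (hasFDerivAt_prodMk_right x 0)).fderiv

lemma partialX_eq {f : Vec n × Vec r → Vec n} (hf : Differentiable ℝ f) (x : Vec n) :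
    partialX f x = (fderiv ℝ f (x, 0)).comp (ContinuousLinearMap.inl ℝ (Vec n) (Vec r)) :=
  ((hf (x, 0)).hasFDerivAt.comp x (hasFDerivAt_prodMk_left x 0)).fderiv

lemma contDiff_partialU {f : Vec n × Vec r → Vec n} {m : ℕ} (hf : ContDiff ℝ (m + 1 : ℕ) f) :
    ContDiff ℝ m (partialU f) := by
  have h1 : partialU f = fun x =>
      (fderiv ℝ f (x, 0)).comp (ContinuousLinearMap.inr ℝ (Vec n) (Vec r)) :=
    funext fun x => partialU_eq (hf.differentiable (by simp)) x
  rw [h1]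
  have h2 : ContDiff ℝ m (fderiv ℝ f) := hf.fderiv_right (by push_cast; exact le_rfl)
  exact (h2.comp (contDiff_id.prodMk contDiff_const)).clm_comp contDiff_const

lemma coeffP_perturbed (f : Vec n × Vec r → Vec n) (xbar F : Vec n) (i : ℕ) :
    coeffP (perturbed f F) xbar i = ((1 : ℝ) / (i.factorial : ℝ)) • iteratedDeriv i
      (fun s : ℝ => partialX f (xbar + totalShift (perturbed f F) xbar s)) 0 := by
  simp only [coeffP, partialX, perturbed, fderiv_add_const]

lemma coeffQ_perturbed (f : Vec n × Vec r → Vec n) (xbar F : Vec n) (i : ℕ) :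
    coeffQ (perturbed f F) xbar i = ((1 : ℝ) / (i.factorial : ℝ)) • iteratedDeriv i
      (fun s : ℝ => partialU f (xbar + totalShift (perturbed f F) xbar s)) 0 := by
  simp only [coeffQ, partialU, perturbed, fderiv_add_const]

/-- The space of the coefficients `P₁, …, P_n, Q₁, …, Q_{2n}`. -/
abbrev CoeffSpace (n r : ℕ) : Type :=
  (Fin n → Vec n →L[ℝ] Vec n) × (Fin (2 * n) → Vec r →L[ℝ] Vec n)

/-- The polynomial `P₁ + s P₂ + ⋯ + s^{n-1} P_n`. -/
noncomputable def polyP (z : CoeffSpace n r × ℝ) : Vec n →L[ℝ] Vec n :=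
  ∑ i : Fin n, z.2 ^ (i : ℕ) • z.1.1 i

/-- The polynomial `Q₁ + s Q₂ + ⋯ + s^{2n-1} Q_{2n}`. -/
noncomputable def polyQ (z : CoeffSpace n r × ℝ) : Vec r →L[ℝ] Vec n :=
  ∑ i : Fin (2 * n), z.2 ^ (i : ℕ) • z.1.2 i

lemma contDiff_polyP : ContDiff ℝ ∞ (polyP : CoeffSpace n r × ℝ → _) := by
  unfold polyP
  fun_prop

lemma contDiff_polyQ : ContDiff ℝ ∞ (polyQ : CoeffSpace n r × ℝ → _) := by
  unfold polyQ
  fun_prop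

/-- The coefficients of the linear system which belongs to the data `θ = (x̄, F)`. -/
noncomputable def systemCoeff (f : Vec n × Vec r → Vec n) (θ : Vec n × Vec n) : CoeffSpace n r :=
  (fun i => coeffP (perturbed f θ.2) θ.1 i, fun i => coeffQ (perturbed f θ.2) θ.1 i)

lemma polyP_systemCoeff (f : Vec n × Vec r → Vec n) (θ : Vec n × Vec n) (s : ℝ) :
    polyP (systemCoeff f θ, s) =
      ∑ i ∈ Finset.range n, s ^ i • coeffP (perturbed f θ.2) θ.1 i := by
  rw [polyP, Finset.sum_range]
  rfl

lemma polyQ_systemCoeff (f : Vec n × Vec r → Vec n) (θ : Vec n × Vec n) (s : ℝ) :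
    polyQ (systemCoeff f θ, s) =
      ∑ i ∈ Finset.range (2 * n), s ^ i • coeffQ (perturbed f θ.2) θ.1 i := by
  rw [polyQ, Finset.sum_range]
  rfl

lemma linP_eq (f : Vec n × Vec r → Vec n) (θ : Vec n × Vec n) (τ : ℝ) :
    linP (perturbed f θ.2) 1 θ.1 τ =
      Real.exp (-τ) • polyP (systemCoeff f θ, Real.exp (-τ)) := by
  rw [polyP_systemCoeff, linP, Finset.smul_sum]
  refine Finset.sum_congr rfl fun i _ => ?_
  rw [smul_smul, ← pow_succ', ← Real.exp_nat_mul]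
  congr 1
  push_cast
  ring_nf

lemma linQ_eq (f : Vec n × Vec r → Vec n) (θ : Vec n × Vec n) (τ : ℝ) :
    linQ (perturbed f θ.2) 1 θ.1 τ =
      Real.exp (-τ) • polyQ (systemCoeff f θ, Real.exp (-τ)) := by
  rw [polyQ_systemCoeff, linQ, Finset.smul_sum]
  refine Finset.sum_congr rfl fun i _ => ?_
  rw [smul_smul, ← pow_succ', ← Real.exp_nat_mul]
  congr 1
  push_cast
  ring_nf

variable {f : Vec n × Vec r → Vec n}

lemma continuous_iteratedDeriv_totalShift (hf : ContDiff ℝ (4 * n : ℕ) f) {Y : Type*}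
    [NormedAddCommGroup Y] [NormedSpace ℝ Y] {G : Vec n × Vec n → Y} {m k : ℕ}
    (hG : ContDiff ℝ m G) (hk : k ≤ m) :
    Continuous fun z : (Vec n × Vec n) × ℝ =>
      iteratedDeriv k (fun s => G (z.1.1 + totalShift (perturbed f z.1.2) z.1.1 s, z.1.2)) z.2 :=
  continuous_iteratedDeriv_shift hG hk fun j hj => continuous_shiftCoeff hf j (by omega)

lemma continuous_systemCoeff (hn : 1 ≤ n) (hf : ContDiff ℝ (4 * n : ℕ) f) :
    Continuous (systemCoeff f) := by
  have hf' : ContDiff ℝ (4 * n - 1 + 1 : ℕ) f := by rwa [Nat.sub_add_cancel (by omega)]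
  refine (continuous_pi fun i => ?_).prodMk (continuous_pi fun i => ?_)
  · simp only [coeffP_perturbed]
    have h := continuous_iteratedDeriv_totalShift hf (k := i) (m := 4 * n - 1)
      (G := fun p : Vec n × Vec n => partialX f p.1) ((contDiff_partialX hf').comp contDiff_fst)
      (by have := i.2; omega)
    exact (h.comp (Continuous.prodMk_left (0 : ℝ))).const_smul ((1 : ℝ) / ((i : ℕ).factorial : ℝ))
  · simp only [coeffQ_perturbed]
    have h := continuous_iteratedDeriv_totalShift hf (k := i) (m := 4 * n - 1)
      (G := fun p : Vec n × Vec n => partialU f p.1) ((contDiff_partialU hf').comp contDiff_fst)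
      (by have := i.2; omega)
    exact (h.comp (Continuous.prodMk_left (0 : ℝ))).const_smul ((1 : ℝ) / ((i : ℕ).factorial : ℝ))

lemma totalShift_zero_param (hf0 : f (0, 0) = 0) (s : ℝ) :
    totalShift (perturbed f 0) 0 s = 0 := shift_zero_param hf0 _ s

/-- A polynomial whose coefficients are the Taylor coefficients of a constant. -/
lemma sum_pow_smul_iteratedDeriv_const {Y : Type*} [NormedAddCommGroup Y] [NormedSpace ℝ Y]
    {N : ℕ} (hN : 1 ≤ N) (c : Y) (s : ℝ) :
    ∑ i ∈ Finset.range N, s ^ i • (((1 : ℝ) / (i.factorial : ℝ)) •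
      iteratedDeriv i (fun _ : ℝ => c) 0) = c := by
  rw [Finset.sum_eq_single_of_mem 0 (Finset.mem_range.2 hN)]
  · simp
  · intro i _ hi
    simp [iteratedDeriv_const, hi]

lemma polyP_systemCoeff_zero (hn : 1 ≤ n) (hf0 : f (0, 0) = 0) (s : ℝ) :
    polyP (systemCoeff f 0, s) = partialX f 0 := by
  rw [polyP_systemCoeff]
  simp only [coeffP_perturbed, Prod.snd_zero, Prod.fst_zero, totalShift_zero_param hf0, add_zero]
  exact sum_pow_smul_iteratedDeriv_const hn _ s

lemma polyQ_systemCoeff_zero (hn : 1 ≤ n) (hf0 : f (0, 0) = 0) (s : ℝ) :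
    polyQ (systemCoeff f 0, s) = partialU f 0 := by
  rw [polyQ_systemCoeff]
  simp only [coeffQ_perturbed, Prod.snd_zero, Prod.fst_zero, totalShift_zero_param hf0, add_zero]
  exact sum_pow_smul_iteratedDeriv_const (by omega) _ s

/-- Truncation errors are uniformly small: they vanish for `θ = 0`, where the path is constant. -/
lemma eventually_taylor_totalShift (hf : ContDiff ℝ (4 * n : ℕ) f) (hf0 : f (0, 0) = 0)
    {Y : Type*} [NormedAddCommGroup Y] [NormedSpace ℝ Y] {G : Vec n × Vec n → Y} {N : ℕ}
    (hN : 1 ≤ N) (hG : ContDiff ℝ N G) {δ : ℝ} (hδ : 0 < δ) :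
    ∀ᶠ θ : Vec n × Vec n in 𝓝 0, ∀ s ∈ Icc (0 : ℝ) 1,
      ‖G (θ.1 + totalShift (perturbed f θ.2) θ.1 s, θ.2)
        - ∑ i ∈ Finset.range N, s ^ i • (((1 : ℝ) / (i.factorial : ℝ)) • iteratedDeriv i
          (fun s : ℝ => G (θ.1 + totalShift (perturbed f θ.2) θ.1 s, θ.2)) 0)‖ ≤ δ * s ^ N := by
  have hcont := continuous_iteratedDeriv_totalShift hf hG (le_refl N)
  have hsmall := eventually_forall_Icc_norm_lt (p₀ := (0 : Vec n × Vec n)) hcont (fun s => by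
    simp only [Prod.snd_zero, Prod.fst_zero, totalShift_zero_param hf0]
    rw [iteratedDeriv_const, if_neg (by omega)]) hδ
  filter_upwards [hsmall] with θ hθ s hs
  refine norm_sub_taylor_le (h := fun s => G (θ.1 + totalShift (perturbed f θ.2) θ.1 s, θ.2))
    ?_ (fun t ht => (hθ t ht).le) hs
  exact hG.comp ((contDiff_const.add (contDiff_shift _ _ _)).prodMk contDiff_const)

lemma eventually_partialX_sub_polyP_le (hn : 1 ≤ n) (hf : ContDiff ℝ (4 * n : ℕ) f)
    (hf0 : f (0, 0) = 0) :
    ∀ᶠ θ : Vec n × Vec n in 𝓝 0, ∀ s ∈ Icc (0 : ℝ) 1,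
      ‖partialX f (θ.1 + totalShift (perturbed f θ.2) θ.1 s) - polyP (systemCoeff f θ, s)‖ ≤
        s ^ n := by
  have h := eventually_taylor_totalShift hf hf0 hn (G := fun p : Vec n × Vec n => partialX f p.1)
    ((contDiff_partialX (hf.of_le (by exact_mod_cast (by omega : n + 1 ≤ 4 * n)))).comp
      contDiff_fst) one_pos
  simpa only [polyP_systemCoeff, coeffP_perturbed, one_mul] using h

lemma eventually_partialU_sub_polyQ_le (hn : 1 ≤ n) (hf : ContDiff ℝ (4 * n : ℕ) f)
    (hf0 : f (0, 0) = 0) :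
    ∀ᶠ θ : Vec n × Vec n in 𝓝 0, ∀ s ∈ Icc (0 : ℝ) 1,
      ‖partialU f (θ.1 + totalShift (perturbed f θ.2) θ.1 s) - polyQ (systemCoeff f θ, s)‖ ≤
        s ^ (2 * n) := by
  have h := eventually_taylor_totalShift hf hf0 (by omega : 1 ≤ 2 * n)
    (G := fun p : Vec n × Vec n => partialU f p.1)
    ((contDiff_partialU (hf.of_le (by exact_mod_cast (by omega : 2 * n + 1 ≤ 4 * n)))).comp
      contDiff_fst) one_pos
  simpa only [polyQ_systemCoeff, coeffQ_perturbed, one_mul] using h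

/-- After all shifts, the terms free of the state and the control are of the order `s^{4n-1}`, with
a small constant. -/
lemma eventually_residual_le (hn : 1 ≤ n) (hf : ContDiff ℝ (4 * n : ℕ) f)
    (hf0 : f (0, 0) = 0) {δ : ℝ} (hδ : 0 < δ) :
    ∀ᶠ θ : Vec n × Vec n in 𝓝 0, ∀ s ∈ Icc (0 : ℝ) 1,
      ‖perturbed f θ.2 (θ.1 + totalShift (perturbed f θ.2) θ.1 s, 0)
        + deriv (totalShift (perturbed f θ.2) θ.1) s‖ ≤ δ * s ^ (4 * n - 1) := by
  have hG : ContDiff ℝ (4 * n - 1 : ℕ) fun p : Vec n × Vec n => f (p.1, 0) + p.2 := by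
    have := hf.of_le (m := (4 * n - 1 : ℕ)) (by exact_mod_cast (by omega))
    fun_prop
  have h := eventually_taylor_totalShift hf hf0 (by omega : 1 ≤ 4 * n - 1) hG hδ
  filter_upwards [h] with θ hθ s hs
  refine le_of_eq_of_le (congrArg _ ?_) (hθ s hs)
  have hO := residual_isBigO hf (by omega) θ.1 θ.2 (4 * n - 1) (by omega)
  have hcoef := taylor_add_eq_zero_of_isBigO
    (h := fun s => f (θ.1 + totalShift (perturbed f θ.2) θ.1 s, 0) + θ.2)
    (hG.comp ((contDiff_const.add (contDiff_shift _ _ _)).prodMk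
      (contDiff_const (c := θ.2)))) hO
  have hd : deriv (totalShift (perturbed f θ.2) θ.1) s = _ :=
    (hasDerivAt_shift (perturbed f θ.2) θ.1 (4 * n - 1) s).deriv
  rw [hd, sub_eq_add_neg, ← Finset.sum_neg_distrib]
  refine congrArg _ (Finset.sum_congr rfl fun i hi => ?_)
  rw [← smul_neg]
  congr 1
  exact eq_neg_of_add_eq_zero_right (hcoef i (Finset.mem_range.1 hi))

end Linearization

/-! ### Estimates of the disturbance, and the rank condition in operator form -/

section Estimates

lemma exists_lipschitzOnWith_closedBall {E F : Type*} [NormedAddCommGroup E] [NormedSpace ℝ E]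
    [FiniteDimensional ℝ E] [NormedAddCommGroup F] [NormedSpace ℝ F] {G : E → F}
    (hG : ContDiff ℝ 1 G) (R : ℝ) : ∃ K : ℝ≥0, LipschitzOnWith K G (closedBall 0 R) := by
  have : ProperSpace E := FiniteDimensional.proper ℝ E
  obtain ⟨C, hC⟩ := (isCompact_closedBall (0 : E) R).exists_bound_of_continuousOn
    (hG.continuous_fderiv (by simp)).continuousOn
  refine ⟨Real.toNNReal C, (convex_closedBall 0 R).lipschitzOnWith_of_nnnorm_fderiv_le (𝕜 := ℝ)
    (fun x _ => hG.differentiable (by simp) x) fun x hx => ?_⟩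
  rw [← NNReal.coe_le_coe]
  exact (hC x hx).trans (Real.le_coe_toNNReal C)

variable {n r : ℕ} {f : Vec n × Vec r → Vec n}

/-- The quadratic remainder of `f` at the points `(a, 0)`. -/
lemma exists_quadratic_remainder (hf : ContDiff ℝ 2 f) :
    ∃ C : ℝ, 0 ≤ C ∧ ∀ (a y : Vec n) (d : Vec r), ‖a‖ ≤ 1 → ‖y‖ ≤ 1 → ‖d‖ ≤ 1 →
      ‖f (a + y, d) - f (a, 0) - partialX f a y - partialU f a d‖ ≤ C * (‖y‖ + ‖d‖) ^ 2 := by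
  have hdiff : Differentiable ℝ f := hf.differentiable (by simp)
  obtain ⟨K, hK⟩ := exists_lipschitzOnWith_closedBall
    (hf.fderiv_right (m := 1) (by norm_num)) 2
  refine ⟨K, K.2, fun a y d ha hy hd => ?_⟩
  set ρ : ℝ := ‖((y, d) : Vec n × Vec r)‖ with hρ
  have hρ1 : ρ ≤ 1 := by rw [hρ, Prod.norm_def]; exact max_le hy hd
  have hρ2 : ρ ≤ ‖y‖ + ‖d‖ := by
    rw [hρ, Prod.norm_def]
    exact max_le (by linarith [norm_nonneg d]) (by linarith [norm_nonneg y])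
  have ha0 : ‖((a, 0) : Vec n × Vec r)‖ ≤ 1 := by
    rw [Prod.norm_def, norm_zero]; exact max_le ha zero_le_one
  have hbound : ∀ z ∈ closedBall ((a, 0) : Vec n × Vec r) ρ,
      ‖fderiv ℝ f z - fderiv ℝ f (a, 0)‖ ≤ K * ρ := by
    intro z hz
    have hz' : ‖z - (a, 0)‖ ≤ ρ := by rwa [mem_closedBall, dist_eq_norm] at hz
    have h1 := hK.norm_sub_le (x := z) (y := (a, 0))
      (by
        rw [mem_closedBall, dist_zero_right]
        linarith [norm_le_norm_sub_add z (a, 0)])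
      (by rw [mem_closedBall, dist_zero_right]; linarith)
    exact h1.trans (by gcongr)
  have h := (convex_closedBall ((a, 0) : Vec n × Vec r) ρ).norm_image_sub_le_of_norm_fderiv_le'
    (𝕜 := ℝ) (f := f) (x := (a, 0)) (y := (a + y, d)) (fun z _ => hdiff z) hbound
    (mem_closedBall_self (norm_nonneg _)) (by simp [dist_eq_norm, hρ])
  have hsplit : fderiv ℝ f (a, 0) ((a + y, d) - (a, 0)) = partialX f a y + partialU f a d := by
    rw [partialX_eq hdiff, partialU_eq hdiff, ContinuousLinearMap.comp_apply,
      ContinuousLinearMap.comp_apply, ← map_add]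
    simp
  rw [hsplit, show ((a + y, d) : Vec n × Vec r) - (a, 0) = (y, d) by simp] at h
  calc _ = ‖f (a + y, d) - f (a, 0) - (partialX f a y + partialU f a d)‖ := by
        congr 1; abel
    _ ≤ K * ρ * ρ := h
    _ = K * ρ ^ 2 := by ring
    _ ≤ K * (‖y‖ + ‖d‖) ^ 2 := by gcongr

/-- The deviation of the shifted system from its truncated linear part, at the time `1 - s`. -/
noncomputable def disturbance (f : Vec n × Vec r → Vec n) (θ : Vec n × Vec n) (s : ℝ) (y : Vec n)
    (d : Vec r) : Vec n :=
  perturbed f θ.2 (θ.1 + (y + totalShift (perturbed f θ.2) θ.1 s), d)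
    + deriv (totalShift (perturbed f θ.2) θ.1) s
    - polyP (systemCoeff f θ, s) y - polyQ (systemCoeff f θ, s) d

/-- The disturbance consists of the quadratic remainder of `f`, of the truncation errors of the
linear part and of the residual of the shifts. Only the constant `δ` of the residual has to be
small; `C` does not depend on it. -/
lemma exists_disturbance_le (hn : 1 ≤ n) (hf : ContDiff ℝ (4 * n : ℕ) f) (hf0 : f (0, 0) = 0) :
    ∃ C : ℝ, 0 ≤ C ∧ ∀ δ : ℝ, 0 < δ → ∀ᶠ θ : Vec n × Vec n in 𝓝 0, ∀ s ∈ Icc (0 : ℝ) 1,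
      ∀ (y : Vec n) (d : Vec r), ‖y‖ ≤ 1 → ‖d‖ ≤ 1 → ‖disturbance f θ s y d‖ ≤
        C * ((‖y‖ + ‖d‖) ^ 2 + s ^ n * ‖y‖ + s ^ (2 * n) * ‖d‖) + δ * s ^ (4 * n - 1) := by
  obtain ⟨C, hC, hquad⟩ := exists_quadratic_remainder
    (hf.of_le (by exact_mod_cast (by omega : 2 ≤ 4 * n)))
  refine ⟨C + 1, by positivity, fun δ hδ => ?_⟩
  have hpath : ∀ᶠ θ : Vec n × Vec n in 𝓝 0, ∀ s ∈ Icc (0 : ℝ) 1,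
      ‖θ.1 + totalShift (perturbed f θ.2) θ.1 s‖ < 1 := by
    have hcont : Continuous fun z : (Vec n × Vec n) × ℝ =>
        z.1.1 + totalShift (perturbed f z.1.2) z.1.1 z.2 :=
      (continuous_fst.comp continuous_fst).add (continuous_shift hf (by omega))
    refine eventually_forall_Icc_norm_lt hcont (fun s => ?_) one_pos
    simp [totalShift_zero_param hf0]
  filter_upwards [hpath, eventually_partialX_sub_polyP_le hn hf hf0,
    eventually_partialU_sub_polyQ_le hn hf hf0, eventually_residual_le hn hf hf0 hδ]
    with θ hθ hP hQ hres s hs y d hy hd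
  set a := θ.1 + totalShift (perturbed f θ.2) θ.1 s with ha
  have hsplit : disturbance f θ s y d =
      (f (a + y, d) - f (a, 0) - partialX f a y - partialU f a d)
      + (partialX f a - polyP (systemCoeff f θ, s)) y
      + (partialU f a - polyQ (systemCoeff f θ, s)) d
      + (perturbed f θ.2 (a, 0) + deriv (totalShift (perturbed f θ.2) θ.1) s) := by
    rw [disturbance, show θ.1 + (y + totalShift (perturbed f θ.2) θ.1 s) = a + y by rw [ha]; abel]
    simp only [perturbed, sub_apply]
    abel
  have h1 := hquad a y d (hθ s hs).le hy hd
  have h2 := ((partialX f a - polyP (systemCoeff f θ, s)).le_opNorm y).trans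
    (mul_le_mul_of_nonneg_right (hP s hs) (norm_nonneg y))
  have h3 := ((partialU f a - polyQ (systemCoeff f θ, s)).le_opNorm d).trans
    (mul_le_mul_of_nonneg_right (hQ s hs) (norm_nonneg d))
  have h4 := hres s hs
  rw [hsplit]
  refine (norm_add₄_le).trans ?_
  have hs0 := hs.1
  have e1 : 0 ≤ (‖y‖ + ‖d‖) ^ 2 := by positivity
  have e2 : 0 ≤ s ^ n * ‖y‖ := by positivity
  have e3 : 0 ≤ s ^ (2 * n) * ‖d‖ := by positivity
  nlinarith [mul_nonneg hC e2, mul_nonneg hC e3]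

lemma ofLp_apply_eq_mulVec {m : ℕ} (L : Vec m →L[ℝ] Vec n) (v : Vec m) :
    (L v).ofLp = (Matrix.of fun i j => L (EuclideanSpace.single j 1) i).mulVec v.ofLp := by
  have h1 : v = ∑ j, v j • EuclideanSpace.single j (1 : ℝ) := by
    ext i
    simp [Finset.sum_apply, Pi.single_apply]
  ext i
  conv_lhs => rw [h1]
  simp only [map_sum, map_smul, Matrix.mulVec, dotProduct, Matrix.of_apply]
  simp [Finset.sum_apply, mul_comm]

/-- The rank condition in operator form: no nonzero vector is orthogonal to the ranges of all
`Aᵏ B`, `k < n`. -/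
lemma eq_zero_of_adjoint_eq_zero
    (hS : (controllabilityMatrix (jacX f) (jacU f)).rank = n) (w : Vec n)
    (hw : ∀ k < n, ContinuousLinearMap.adjoint ((partialX f 0 ^ k).comp (partialU f 0)) w = 0) :
    w = 0 := by
  have hA : ∀ v : Vec n, (partialX f 0 v).ofLp = (jacX f).mulVec v.ofLp :=
    ofLp_apply_eq_mulVec (partialX f 0)
  have hB : ∀ v : Vec r, (partialU f 0 v).ofLp = (jacU f).mulVec v.ofLp :=
    ofLp_apply_eq_mulVec (partialU f 0)
  have hAB : ∀ (k : ℕ) (v : Vec r), (((partialX f 0 ^ k).comp (partialU f 0)) v).ofLp =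
      (jacX f ^ k * jacU f).mulVec v.ofLp := by
    intro k v
    induction k with
    | zero => simpa using hB v
    | succ k ih =>
      rw [pow_succ', pow_succ', ContinuousLinearMap.comp_apply, mul_apply_eq_comp, hA,
        Matrix.mul_assoc, ← Matrix.mulVec_mulVec, ← ih]
      rfl
  have horth : ∀ k < n, ∀ v : Vec r,
      dotProduct w.ofLp ((jacX f ^ k * jacU f).mulVec v.ofLp) = 0 := by
    intro k hk v
    have h1 := ContinuousLinearMap.adjoint_inner_right ((partialX f 0 ^ k).comp (partialU f 0)) v w
    rw [hw k hk, inner_zero_right, EuclideanSpace.inner_eq_star_dotProduct, hAB] at h1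
    simpa using h1.symm
  -- `w` is orthogonal to all columns of the matrix, hence to its range, which is the whole space
  have hcol : Matrix.vecMul w.ofLp (controllabilityMatrix (jacX f) (jacU f)) = 0 := by
    funext p
    have h1 := horth p.1 p.1.2 (EuclideanSpace.single p.2 1)
    simpa [Matrix.vecMul, controllabilityMatrix, dotProduct] using h1
  have hrange : LinearMap.range (controllabilityMatrix (jacX f) (jacU f)).mulVecLin = ⊤ := by
    apply Submodule.eq_top_of_finrank_eq
    rw [← Matrix.rank, hS]
    simp
  obtain ⟨v, hv⟩ : w.ofLp ∈
      LinearMap.range (controllabilityMatrix (jacX f) (jacU f)).mulVecLin := by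
    rw [hrange]; trivial
  have h0 : dotProduct w.ofLp w.ofLp = 0 := by
    nth_rw 2 [← hv]
    rw [Matrix.mulVecLin_apply, Matrix.dotProduct_mulVec, hcol, zero_dotProduct]
  ext i
  exact congrFun (dotProduct_self_eq_zero.1 h0) i

end Estimates

/-! ### Vector fields, the fundamental matrix and the return to the original time -/

section Fields

lemma isLocLipField_feedback {V U : Type*} [NormedAddCommGroup V] [NormedSpace ℝ V]
    [FiniteDimensional ℝ V] [NormedAddCommGroup U] [NormedSpace ℝ U] [FiniteDimensional ℝ U]
    {G : V × U → V} (hG : ContDiff ℝ 1 G) {a : ℝ → ℝ} {β γ : ℝ → V} {M : ℝ → V →L[ℝ] U}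
    (ha : ContinuousOn a (Ici 0)) (hβ : ContinuousOn β (Ici 0)) (hγ : ContinuousOn γ (Ici 0))
    (hM : ContinuousOn M (Ici 0)) :
    IsLocLipField fun τ y => a τ • (G (β τ + y, M τ y) + γ τ) := by
  refine ⟨fun y => ?_, fun T R => ?_⟩
  · exact ha.smul ((hG.continuous.comp_continuousOn ((hβ.add continuousOn_const).prodMk
      (hM.clm_apply continuousOn_const))).add hγ)
  · have hsub : Icc (0 : ℝ) T ⊆ Ici 0 := Icc_subset_Ici_self
    obtain ⟨A, hA⟩ := isCompact_Icc.exists_bound_of_continuousOn (ha.mono hsub)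
    obtain ⟨B, hB⟩ := isCompact_Icc.exists_bound_of_continuousOn (hβ.mono hsub)
    obtain ⟨D, hD⟩ := isCompact_Icc.exists_bound_of_continuousOn (hM.mono hsub)
    obtain ⟨K, hK⟩ := exists_lipschitzOnWith_closedBall hG (max (B + R) (D * R))
    refine ⟨Real.toNNReal (A * (K * (1 + D))), fun τ hτ => ?_⟩
    have hA0 : 0 ≤ A := (norm_nonneg _).trans (hA τ hτ)
    have hD0 : 0 ≤ D := (norm_nonneg _).trans (hD τ hτ)
    have hMle : ∀ y, ‖M τ y‖ ≤ D * ‖y‖ := fun y =>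
      ((M τ).le_opNorm y).trans (mul_le_mul_of_nonneg_right (hD τ hτ) (norm_nonneg y))
    have hmem : ∀ y ∈ closedBall (0 : V) R,
        (β τ + y, M τ y) ∈ closedBall (0 : V × U) (max (B + R) (D * R)) := by
      intro y hy
      rw [mem_closedBall, dist_zero_right] at hy ⊢
      rw [Prod.norm_def]
      refine max_le_max ((norm_add_le _ _).trans (add_le_add (hB τ hτ) hy)) ?_
      exact (hMle y).trans (by gcongr)
    refine LipschitzOnWith.of_dist_le_mul fun y hy z hz => ?_
    rw [Real.coe_toNNReal _ (by positivity), dist_eq_norm, dist_eq_norm, ← smul_sub, norm_smul,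
      add_sub_add_right_eq_sub]
    have h1 := hK.norm_sub_le (hmem y hy) (hmem z hz)
    have h2 : ‖(β τ + y, M τ y) - (β τ + z, M τ z)‖ ≤ (1 + D) * ‖y - z‖ := by
      rw [Prod.mk_sub_mk, add_sub_add_left_eq_sub, ← map_sub, Prod.norm_def]
      have h3 := hMle (y - z)
      have h4 := norm_nonneg (y - z)
      exact max_le (by nlinarith) (by nlinarith)
    calc _ ≤ A * (K * ((1 + D) * ‖y - z‖)) := by
          gcongr
          · exact hA τ hτ
          · exact h1.trans (by gcongr)
      _ = _ := by ring

lemma isLocLipField_linear {V : Type*} [NormedAddCommGroup V] [NormedSpace ℝ V]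
    {L : ℝ → V →L[ℝ] V} (hL : ContinuousOn L (Ici 0)) : IsLocLipField fun τ y => L τ y := by
  refine ⟨fun y => hL.clm_apply continuousOn_const, fun T R => ?_⟩
  obtain ⟨A, hA⟩ := isCompact_Icc.exists_bound_of_continuousOn
    (hL.mono (Icc_subset_Ici_self : Icc (0 : ℝ) T ⊆ Ici 0))
  refine ⟨Real.toNNReal A, fun τ hτ => ?_⟩
  exact ((L τ).lipschitz.weaken (NNReal.le_toNNReal_of_coe_le (hA τ hτ))).lipschitzOnWith

/-- Decaying solutions for all small initial vectors give a decaying fundamental matrix. -/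
lemma exists_fundamental_matrix {n l : ℕ} {L : ℝ → Vec n →L[ℝ] Vec n} {ρ C : ℝ} (hρ : 0 < ρ)
    (hC : 0 ≤ C)
    (h : ∀ y₀ : Vec n, ‖y₀‖ ≤ ρ → ∃ c : ℝ → Vec n, c 0 = y₀ ∧
      (∀ τ ∈ Ici (0 : ℝ), HasDerivWithinAt c (L τ (c τ)) (Ici 0) τ) ∧
      ∀ τ ∈ Ici (0 : ℝ), ‖c τ‖ ≤ C * Real.exp (-τ) ^ l) :
    ∃ Φ : ℝ → Vec n →L[ℝ] Vec n, Φ 0 = ContinuousLinearMap.id ℝ (Vec n) ∧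
      (∀ τ ∈ Ici (0 : ℝ), HasDerivWithinAt Φ ((L τ).comp (Φ τ)) (Ici 0) τ) ∧
      ∃ K : ℝ, 0 < K ∧ ∀ τ ∈ Ici (0 : ℝ), ‖Φ τ‖ ≤ K * Real.exp (-((l : ℝ) * τ)) := by
  choose c hc0 hc hcC using fun j : Fin n => h (ρ • EuclideanSpace.single j (1 : ℝ)) (by
    rw [norm_smul, Real.norm_of_nonneg hρ.le]; simp)
  let π : Fin n → Vec n →L[ℝ] ℝ := fun j => EuclideanSpace.proj j
  refine ⟨fun τ => ∑ j, (π j).smulRight (ρ⁻¹ • c j τ), ?_, fun τ hτ => ?_,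
    ∑ j, ‖π j‖ * (ρ⁻¹ * C) + 1, by positivity, fun τ hτ => ?_⟩
  · ext v i
    simp only [sum_apply, ContinuousLinearMap.smulRight_apply, hc0, smul_smul,
      inv_mul_cancel₀ hρ.ne', ContinuousLinearMap.id_apply]
    simp [π, Finset.sum_apply, Pi.single_apply]
  · have h1 : (L τ).comp (∑ j, (π j).smulRight (ρ⁻¹ • c j τ)) =
        ∑ j, (π j).smulRight (ρ⁻¹ • L τ (c j τ)) := by
      ext v : 1
      simp
    rw [h1]
    refine HasDerivWithinAt.fun_sum fun j _ => ?_
    exact (ContinuousLinearMap.smulRightL ℝ (Vec n) (Vec n) (π j)).hasFDerivAt.comp_hasDerivWithinAt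
      τ ((hc j τ hτ).const_smul ρ⁻¹)
  · have hexp : Real.exp (-τ) ^ l = Real.exp (-((l : ℝ) * τ)) := by
      rw [← Real.exp_nat_mul]; ring_nf
    have h1 : ‖∑ j, (π j).smulRight (ρ⁻¹ • c j τ)‖ ≤
        ∑ j, ‖π j‖ * (ρ⁻¹ * C) * Real.exp (-((l : ℝ) * τ)) := by
      refine (norm_sum_le _ _).trans (Finset.sum_le_sum fun j _ => ?_)
      rw [ContinuousLinearMap.norm_smulRight_apply, norm_smul, mul_assoc, mul_assoc, ← hexp,
        Real.norm_of_nonneg (inv_nonneg.2 hρ.le)]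
      have := hcC j τ hτ
      gcongr
    refine h1.trans ?_
    rw [← Finset.sum_mul]
    exact mul_le_mul_of_nonneg_right (by linarith) (Real.exp_pos _).le

lemma continuousOn_gramFeedback {V U : Type*} [NormedAddCommGroup V] [InnerProductSpace ℝ V]
    [CompleteSpace V] [NormedAddCommGroup U] [InnerProductSpace ℝ U] [CompleteSpace U] {b m : ℕ}
    {q : ℕ → ℝ → U →L[ℝ] V} (hq : ∀ k, Continuous (q k))
    (hu : ∀ s ∈ Ioc (0 : ℝ) 1, IsUnit (gramian b m q s)) :
    ContinuousOn (gramFeedback b m q) (Ici 0) := by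
  have hadj : ∀ k, Continuous fun s => ContinuousLinearMap.adjoint (q k s) := fun k =>
    (ContinuousLinearMap.adjoint (𝕜 := ℝ) (E := U) (F := V)).continuous.comp (hq k)
  have hgram : Continuous (gramian b m q) := by
    unfold gramian
    refine continuous_finsetSum _ fun j _ => continuous_finsetSum _ fun k _ => ?_
    exact (continuous_const.mul (continuous_id.pow _)).smul ((hq j).clm_comp (hadj k))
  have hexp : Continuous fun τ : ℝ => Real.exp (-τ) := by fun_prop
  intro τ hτ
  refine ContinuousAt.continuousWithinAt ?_
  obtain ⟨u, hu'⟩ := hu (Real.exp (-τ))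
    ⟨Real.exp_pos _, Real.exp_le_one_iff.2 (neg_nonpos.2 hτ)⟩
  have h0 : ContinuousAt Ring.inverse (gramian b m q (Real.exp (-τ))) := by
    rw [← hu']
    exact NormedRing.inverse_continuousAt u
  have h1 : ContinuousAt (fun τ : ℝ => Ring.inverse (gramian b m q (Real.exp (-τ)))) τ :=
    ContinuousAt.comp (g := (Ring.inverse : (V →L[ℝ] V) → V →L[ℝ] V))
      (f := fun τ : ℝ => gramian b m q (Real.exp (-τ))) h0 (hgram.comp hexp).continuousAt
  exact (((hadj 0).comp hexp).continuousAt.clm_comp h1).const_smul (-(1 / 2 : ℝ))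

end Fields

section Boundary

variable {n r : ℕ}

/-- Return to the original time: a solution of the auxiliary system which decays, together with its
control, as `τ → ∞`, yields a solution of the boundary value problem. -/
lemma exists_isBVPSolution {g : Vec n × Vec r → Vec n} (hg : Continuous g) {N : ℝ} (hN : 0 < N)
    {xbar : Vec n} {M : ℝ → Vec n →L[ℝ] Vec r} (hM : ContinuousOn M (Ici 0)) {y : ℝ → Vec n}
    (hy0 : y 0 = -xbar - totalShift g xbar 1)
    (hy : ∀ τ ∈ Ici (0 : ℝ), HasDerivWithinAt y (Real.exp (-τ) •
      (g (xbar + (y τ + totalShift g xbar (Real.exp (-τ))), M τ (y τ))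
        + deriv (totalShift g xbar) (Real.exp (-τ)))) (Ici 0) τ)
    {C : ℝ} {k l : ℕ} (hk : k ≠ 0) (hl : l ≠ 0) (hC : 0 ≤ C) (hCN : C < N)
    (hyC : ∀ τ ∈ Ici (0 : ℝ), ‖y τ‖ ≤ C * Real.exp (-τ) ^ k)
    (hMC : ∀ τ ∈ Ici (0 : ℝ), ‖M τ (y τ)‖ ≤ C * Real.exp (-τ) ^ l) :
    ∃ (x : ℝ → Vec n) (u : ℝ → Vec r), IsBVPSolution g N xbar x u ∧
      ∀ t ∈ Ico (0 : ℝ) 1,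
        x t = xbar + (y (newTime 1 t) + totalShift g xbar (1 - t)) ∧
        u t = M (newTime 1 t) (y (newTime 1 t)) := by
  have hT : ∀ t ∈ Ico (0 : ℝ) 1, newTime 1 t ∈ Ici (0 : ℝ) := by
    intro t ht
    rw [newTime, div_one, mem_Ici, neg_nonneg]
    exact Real.log_nonpos (by linarith [ht.2]) (by linarith [ht.1])
  have hTexp : ∀ t ∈ Ico (0 : ℝ) 1, Real.exp (-newTime 1 t) = 1 - t := by
    intro t ht
    rw [newTime, div_one, neg_neg, Real.exp_log (by linarith [ht.2])]
  have hTd : ∀ t ∈ Ico (0 : ℝ) 1, HasDerivAt (newTime 1) (1 - t)⁻¹ t := by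
    intro t ht
    have h0 : 1 - t ≠ 0 := by linarith [ht.2]
    have h1 := (((hasDerivAt_id t).const_sub 1).log h0).neg.div_const 1
    convert! h1 using 1
    simp [div_eq_mul_inv]
  have hyc : ContinuousOn y (Ici 0) := fun τ hτ => (hy τ hτ).continuousWithinAt
  have hTc : ContinuousOn (newTime 1) (Ico 0 1) := fun t ht =>
    (hTd t ht).continuousAt.continuousWithinAt
  have hσ : Continuous (totalShift g xbar) := (contDiff_shift (m := 0) g xbar _).continuous
  have hσd : ∀ s, HasDerivAt (totalShift g xbar) (deriv (totalShift g xbar) s) s := fun s =>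
    ((contDiff_shift (m := 1) g xbar _).differentiable (by simp) s).hasDerivAt
  let x : ℝ → Vec n := fun t =>
    if t < 1 then xbar + (y (newTime 1 t) + totalShift g xbar (1 - t)) else xbar
  let u : ℝ → Vec r := fun t => if t < 1 then M (newTime 1 t) (y (newTime 1 t)) else 0
  have hx : ∀ t ∈ Ico (0 : ℝ) 1,
      x t = xbar + (y (newTime 1 t) + totalShift g xbar (1 - t)) := fun t ht => if_pos ht.2
  have hu : ∀ t ∈ Ico (0 : ℝ) 1, u t = M (newTime 1 t) (y (newTime 1 t)) := fun t ht => if_pos ht.2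
  have hx1 : x 1 = xbar := if_neg (lt_irrefl 1)
  have hu1 : u 1 = 0 := if_neg (lt_irrefl 1)
  have hT0 : newTime 1 0 = 0 := by simp [newTime]
  -- the differential equation before the final time
  have hode : ∀ t ∈ Ico (0 : ℝ) 1, HasDerivWithinAt x (g (x t, u t)) (Ico 0 1) t := by
    intro t ht
    have h0 : 1 - t ≠ 0 := by linarith [ht.2]
    have h1 := (hy _ (hT t ht)).scomp t (hTd t ht).hasDerivWithinAt (fun s hs => hT s hs)
    have h2 : HasDerivAt (fun s : ℝ => totalShift g xbar (1 - s))
        (-deriv (totalShift g xbar) (1 - t)) t := by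
      have h3 := (hσd (1 - t)).scomp t ((hasDerivAt_id t).const_sub 1)
      convert! h3 using 1
      simp
    have h4 := (h1.add h2.hasDerivWithinAt).const_add xbar
    refine (h4.congr_deriv ?_).congr_of_eventuallyEq ?_ (hx t ht)
    · rw [hTexp t ht, smul_smul, inv_mul_cancel₀ h0, one_smul, hx t ht, hu t ht]
      abel
    · filter_upwards [self_mem_nhdsWithin] with s hs
      exact hx s hs
  -- state and control converge as the final time is approached
  have hlim : ∀ {j : ℕ}, j ≠ 0 → Tendsto (fun t : ℝ => C * (1 - t) ^ j) (𝓝[<] 1) (𝓝 0) := by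
    intro j hj
    have h1 : Continuous fun t : ℝ => C * (1 - t) ^ j := by fun_prop
    simpa [hj] using (h1.tendsto 1).mono_left (nhdsWithin_le_nhds (s := Iio 1))
  have hev : ∀ᶠ t in 𝓝[<] (1 : ℝ), t ∈ Ico (0 : ℝ) 1 := Ico_mem_nhdsLT zero_lt_one
  have hulim : Tendsto u (𝓝[<] 1) (𝓝 0) := by
    refine squeeze_zero_norm' ?_ (hlim hl)
    filter_upwards [hev] with t ht
    rw [hu t ht, ← hTexp t ht]
    exact hMC _ (hT t ht)
  have hxlim : Tendsto x (𝓝[<] 1) (𝓝 xbar) := by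
    have h1 : Tendsto (fun t => y (newTime 1 t)) (𝓝[<] 1) (𝓝 0) := by
      refine squeeze_zero_norm' ?_ (hlim hk)
      filter_upwards [hev] with t ht
      rw [← hTexp t ht]
      exact hyC _ (hT t ht)
    have h2 : Tendsto (fun t : ℝ => totalShift g xbar (1 - t)) (𝓝[<] 1) (𝓝 0) := by
      have h3 : Continuous fun t : ℝ => totalShift g xbar (1 - t) := by fun_prop
      have h4 := (h3.tendsto 1).mono_left (nhdsWithin_le_nhds (s := Iio 1))
      rwa [sub_self, totalShift, shift_zero_right] at h4
    have h5 := (h1.add h2).const_add xbar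
    rw [add_zero, add_zero] at h5
    refine h5.congr' ?_
    filter_upwards [hev] with t ht
    exact (hx t ht).symm
  have hglim : Tendsto (fun t => g (x t, u t)) (𝓝[<] 1) (𝓝 (g (xbar, 0))) :=
    (hg.tendsto _).comp (hxlim.prodMk_nhds hulim)
  have hIcc : ∀ t ∈ Icc (0 : ℝ) 1, t ∈ Ico (0 : ℝ) 1 ∨ t = 1 := fun t ht => by
    rcases ht.2.lt_or_eq with h | h
    · exact Or.inl ⟨ht.1, h⟩
    · exact Or.inr h
  have hnhds : ∀ t ∈ Ico (0 : ℝ) 1, Ico (0 : ℝ) 1 ∈ 𝓝[Icc 0 1] t := fun t ht => by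
    filter_upwards [self_mem_nhdsWithin, nhdsWithin_le_nhds (Iio_mem_nhds ht.2)] with s hs hs'
    exact ⟨hs.1, hs'⟩
  have hode1 : ∀ t ∈ Icc (0 : ℝ) 1, HasDerivWithinAt x (g (x t, u t)) (Icc 0 1) t := by
    intro t ht
    rcases hIcc t ht with h | rfl
    · exact (hode t h).mono_of_mem_nhdsWithin (hnhds t h)
    · have hint : ∀ s ∈ Ioo (0 : ℝ) 1, HasDerivAt x (g (x s, u s)) s := fun s hs =>
        (hode s (Ioo_subset_Ico_self hs)).hasDerivAt (Ico_mem_nhds hs.1 hs.2)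
      rw [hx1, hu1]
      refine (hasDerivWithinAt_Iic_of_tendsto_deriv (s := Ioo 0 1)
        (fun s hs => (hint s hs).differentiableAt.differentiableWithinAt) ?_
        (Ioo_mem_nhdsLT zero_lt_one) ?_).mono Icc_subset_Iic_self
      · rw [ContinuousWithinAt, hx1]
        exact hxlim.mono_left (nhdsWithin_mono _ Ioo_subset_Iio_self)
      · refine hglim.congr' ?_
        filter_upwards [Ioo_mem_nhdsLT (zero_lt_one' ℝ)] with s hs
        exact (hint s hs).deriv.symm
  refine ⟨x, u, ⟨fun t ht => (hode1 t ht).continuousWithinAt, fun t ht => ?_, hode1,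
    fun t ht => ?_, ?_, hx1⟩, fun t ht => ⟨hx t ht, hu t ht⟩⟩
  · rcases hIcc t ht with h | rfl
    · have h1 : ContinuousOn (fun t => M (newTime 1 t) (y (newTime 1 t))) (Ico 0 1) :=
        (hM.comp hTc hT).clm_apply (hyc.comp hTc hT)
      exact ((h1.congr hu) t h).mono_of_mem_nhdsWithin (hnhds t h)
    · have h1 : ContinuousWithinAt u (Iio 1) 1 := by rw [ContinuousWithinAt, hu1]; exact hulim
      have h2 := continuousWithinAt_insert_self.2 h1
      rw [Iio_insert] at h2
      exact h2.mono Icc_subset_Iic_self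
  · rcases hIcc t ht with h | rfl
    · rw [hu t h]
      refine (hMC _ (hT t h)).trans_lt (lt_of_le_of_lt ?_ hCN)
      rw [hTexp t h]
      exact mul_le_of_le_one_right hC (pow_le_one₀ (by linarith [h.2]) (by linarith [h.1]))
    · rw [hu1, norm_zero]
      exact hN
  · rw [hx 0 ⟨le_rfl, zero_lt_one⟩, hT0, hy0, sub_zero]
    abel

end Boundary

/-! ### Synthesis of the control -/

section Synthesis

variable {n r : ℕ} {f : Vec n × Vec r → Vec n}

/-- The brackets of the truncated linear part which belongs to the data `θ = (x̄, F)`. -/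
noncomputable def systemChain (f : Vec n × Vec r → Vec n) (θ : Vec n × Vec n) (k : ℕ) (s : ℝ) :
    Vec r →L[ℝ] Vec n :=
  chain polyP polyQ k (systemCoeff f θ, s)

/-- The feedback for the data `θ = (x̄, F)`: the Gramian is truncated after `2n` brackets, and the
exponent `6n + 2` of its weight is the decay rate which the energy needs. -/
noncomputable def synthFeedback (f : Vec n × Vec r → Vec n) (θ : Vec n × Vec n) :
    ℝ → Vec n →L[ℝ] Vec r :=
  gramFeedback (6 * n + 2) (2 * n) (systemChain f θ)

lemma continuous_systemChain (f : Vec n × Vec r → Vec n) (θ : Vec n × Vec n) (k : ℕ) :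
    Continuous (systemChain f θ k) :=
  (contDiff_chain contDiff_polyP contDiff_polyQ k).continuous.comp
    (continuous_const.prodMk continuous_id)

lemma auxField_eq (g : Vec n × Vec r → Vec n) (xbar : Vec n) (τ : ℝ) (y : Vec n) (d : Vec r) :
    auxField g 1 xbar τ y d = Real.exp (-τ) •
      (g (xbar + (y + totalShift g xbar (Real.exp (-τ))), d)
        + deriv (totalShift g xbar) (Real.exp (-τ))) := by
  have h1 : HasDerivAt (totalShift g xbar) (deriv (totalShift g xbar) (Real.exp (-τ)))
      (Real.exp (-τ)) :=
    ((contDiff_shift (m := 1) g xbar _).differentiable (by simp) _).hasDerivAt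
  have h2 : HasDerivAt (fun ρ : ℝ => Real.exp (-ρ)) (-Real.exp (-τ)) τ := by
    simpa using (hasDerivAt_neg τ).exp
  have h3 : deriv (fun ρ : ℝ => totalShift g xbar (Real.exp (-ρ))) τ = _ := (h1.scomp τ h2).deriv
  simp only [auxField, one_mul]
  rw [h3, neg_smul, sub_neg_eq_add, smul_add]

lemma closedField_disturbance (f : Vec n × Vec r → Vec n) (θ : Vec n × Vec n) (τ : ℝ)
    (y : Vec n) :
    closedField (6 * n + 2) (2 * n) (fun s => polyP (systemCoeff f θ, s)) (systemChain f θ)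
      (fun τ y => disturbance f θ (Real.exp (-τ)) y (synthFeedback f θ τ y)) τ y =
    auxField (perturbed f θ.2) 1 θ.1 τ y (synthFeedback f θ τ y) := by
  rw [auxField_eq, closedField, disturbance]
  congr 1
  change _ + polyQ (systemCoeff f θ, Real.exp (-τ)) (synthFeedback f θ τ y) + _ = _
  abel

lemma closedField_zero (f : Vec n × Vec r → Vec n) (θ : Vec n × Vec n) (τ : ℝ) (y : Vec n) :
    closedField (6 * n + 2) (2 * n) (fun s => polyP (systemCoeff f θ, s)) (systemChain f θ)
      (fun _ _ => 0) τ y =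
    (linP (perturbed f θ.2) 1 θ.1 τ
      + (linQ (perturbed f θ.2) 1 θ.1 τ).comp (synthFeedback f θ τ)) y := by
  rw [linP_eq, linQ_eq, closedField, add_zero, smul_add]
  rfl

lemma isLocLipField_auxField (hf : ContDiff ℝ 1 f) (θ : Vec n × Vec n)
    (hM : ContinuousOn (synthFeedback f θ) (Ici 0)) :
    IsLocLipField fun τ y =>
      auxField (perturbed f θ.2) 1 θ.1 τ y (synthFeedback f θ τ y) := by
  have hexp : Continuous fun τ : ℝ => Real.exp (-τ) := by fun_prop
  have hσ : ContDiff ℝ 1 (totalShift (perturbed f θ.2) θ.1) := contDiff_shift _ _ _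
  have h := isLocLipField_feedback hf (a := fun τ => Real.exp (-τ))
    (β := fun τ => θ.1 + totalShift (perturbed f θ.2) θ.1 (Real.exp (-τ)))
    (γ := fun τ => θ.2 + deriv (totalShift (perturbed f θ.2) θ.1) (Real.exp (-τ)))
    hexp.continuousOn (continuous_const.add (hσ.continuous.comp hexp)).continuousOn
    (continuous_const.add ((hσ.continuous_deriv (by simp)).comp hexp)).continuousOn hM
  convert! h using 3 with τ y
  rw [auxField_eq, perturbed, add_assoc (f _), add_assoc θ.1,
    add_comm (totalShift (perturbed f θ.2) θ.1 (Real.exp (-τ))) y]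

lemma continuous_linP (g : Vec n × Vec r → Vec n) (α : ℝ) (xbar : Vec n) :
    Continuous (linP g α xbar) := by
  unfold linP
  fun_prop

lemma continuous_linQ (g : Vec n × Vec r → Vec n) (α : ℝ) (xbar : Vec n) :
    Continuous (linQ g α xbar) := by
  unfold linQ
  fun_prop

/-- The feedback, the solution of the auxiliary problem and the solution of the boundary value
problem, for all sufficiently small data `θ = (x̄, F)`. -/
theorem eventually_exists_synthesis (hn : 1 ≤ n) (hf : ContDiff ℝ (4 * n : ℕ) f)
    (hf0 : f (0, 0) = 0) (hS : (controllabilityMatrix (jacX f) (jacU f)).rank = n)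
    {N : ℝ} (hN : 0 < N) :
    ∀ᶠ θ : Vec n × Vec n in 𝓝 0, ∃ M : ℝ → Vec n →L[ℝ] Vec r,
      IsStabilizing (linP (perturbed f θ.2) 1 θ.1) (linQ (perturbed f θ.2) 1 θ.1) M ∧
      ∃ y : ℝ → Vec n, IsAuxIVPSolution (perturbed f θ.2) 1 θ.1 M y ∧
        (∀ y' : ℝ → Vec n, IsAuxIVPSolution (perturbed f θ.2) 1 θ.1 M y' → EqOn y' y (Ici 0)) ∧
        ∃ (x : ℝ → Vec n) (u : ℝ → Vec r), IsBVPSolution (perturbed f θ.2) N θ.1 x u ∧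
          ∀ t ∈ Ico (0 : ℝ) 1,
            x t = θ.1 + (y (newTime 1 t) + totalShift (perturbed f θ.2) θ.1 (1 - t)) ∧
            u t = M (newTime 1 t) (y (newTime 1 t)) := by
  obtain ⟨C, κ, hC, hκ, hchain⟩ := eventually_chainBounds hn contDiff_polyP contDiff_polyQ
    (polyP_systemCoeff_zero hn hf0) (polyQ_systemCoeff_zero hn hf0) (eq_zero_of_adjoint_eq_zero hS)
  obtain ⟨CR, hCR, hdist⟩ := exists_disturbance_le hn hf hf0
  have hm : 2 * n - 1 + 1 = 2 * n := by omega
  obtain ⟨K, hK1, hK⟩ := exists_decaying_solution (Vec n) (Vec r) hn hm hC hκ hCR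
  simp only [hm] at hK
  have hK0 : 0 < K := by linarith
  -- `e` is the size of the trapping region: the state stays below `1`, the control below `N`
  obtain ⟨e, he, he1, heK, heN⟩ : ∃ e : ℝ, 0 < e ∧ e ≤ 1 ∧ K * e ≤ 1 ∧ K * e < N := by
    refine ⟨min 1 (N / 2) / K, by positivity, ?_, ?_, ?_⟩
    · exact (div_le_one hK0).2 ((min_le_left _ _).trans hK1)
    · rw [mul_div_cancel₀ _ hK0.ne']
      exact min_le_left _ _
    · rw [mul_div_cancel₀ _ hK0.ne']
      exact (min_le_right _ _).trans_lt (by linarith)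
  have hδ : 0 < e / 2 / K := by positivity
  have hδe : K * (e / 2 / K) < e := by
    rw [mul_div_cancel₀ _ hK0.ne']
    linarith
  have hinit : ∀ᶠ θ : Vec n × Vec n in 𝓝 0,
      K * ‖-θ.1 - totalShift (perturbed f θ.2) θ.1 1‖ < e := by
    have hcont : Continuous fun θ : Vec n × Vec n =>
        K * ‖-θ.1 - totalShift (perturbed f θ.2) θ.1 1‖ :=
      continuous_const.mul (continuous_fst.neg.sub
        ((continuous_shift hf (N := 4 * n - 1) (by omega)).comp
          (Continuous.prodMk_left (1 : ℝ)))).norm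
    refine hcont.continuousAt.eventually_lt continuousAt_const ?_
    simpa [totalShift_zero_param hf0] using he
  have hf1 : ContDiff ℝ 1 f := hf.of_le (by exact_mod_cast (by omega : 1 ≤ 4 * n))
  filter_upwards [(continuous_systemCoeff hn hf).continuousAt.eventually hchain, hdist _ hδ, hinit]
    with θ hθ hdθ hiθ
  obtain ⟨hunit, hsol⟩ := hK _ (systemChain f θ) hθ
  have hM : ContinuousOn (synthFeedback f θ) (Ici 0) :=
    continuousOn_gramFeedback (continuous_systemChain f θ) hunit
  refine ⟨synthFeedback f θ, ⟨hM, ?_⟩, ?_⟩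
  · -- the undisturbed linear system
    have hlin : IsLocLipField fun τ y => (linP (perturbed f θ.2) 1 θ.1 τ
        + (linQ (perturbed f θ.2) 1 θ.1 τ).comp (synthFeedback f θ τ)) y :=
      isLocLipField_linear ((continuous_linP _ _ _).continuousOn.add
        ((continuous_linQ _ _ _).continuousOn.clm_comp hM))
    obtain ⟨Φ, hΦ0, hΦ, K', hK', hΦK⟩ := exists_fundamental_matrix (l := 3 * n)
      (L := fun τ => linP (perturbed f θ.2) 1 θ.1 τ
        + (linQ (perturbed f θ.2) 1 θ.1 τ).comp (synthFeedback f θ τ))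
      (inv_pos.2 hK0) hK0.le fun y₀ hy₀ => by
        obtain ⟨c, hc0, hc, hcK⟩ := hsol (fun _ _ => 0) 1 0 one_pos le_rfl le_rfl (by simp)
          (fun τ _ y _ _ => by rw [norm_zero]; positivity)
          (by simpa only [← closedField_zero] using hlin) y₀
          (by rwa [← le_inv_mul_iff₀ hK0, mul_one])
        refine ⟨c, hc0, fun τ hτ => ?_, fun τ hτ => ?_⟩
        · simpa only [closedField_zero] using hc τ hτ
        · simpa using (hcK τ hτ).1
    exact ⟨Φ, hΦ0, hΦ, K', hK', (3 * n : ℕ), by exact_mod_cast (by omega : 0 < 3 * n), hΦK⟩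
  · have hfield := isLocLipField_auxField hf1 θ hM
    obtain ⟨y, hy0, hy, hyK⟩ := hsol
      (fun τ y => disturbance f θ (Real.exp (-τ)) y (synthFeedback f θ τ y)) e (e / 2 / K)
      he he1 hδ.le hδe
      (fun τ hτ y hy hd => hdθ _ ⟨(Real.exp_pos _).le, Real.exp_le_one_iff.2 (neg_nonpos.2 hτ)⟩ y _
        (hy.trans heK) (hd.trans heK))
      (by simpa only [← closedField_disturbance] using hfield) _ hiθ.le
    simp only [closedField_disturbance] at hy
    refine ⟨y, ⟨hy0, hy⟩, fun y' hy' => hfield.eqOn_Ici hy'.2 hy (hy'.1.trans hy0.symm), ?_⟩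
    simp only [auxField_eq] at hy
    exact exists_isBVPSolution (hf.continuous.add continuous_const) hN hM hy0 hy (by omega)
      (by omega : 2 * n ≠ 0) (by positivity) heN (fun τ hτ => (hyK τ hτ).1)
      fun τ hτ => (hyK τ hτ).2

end Synthesis

end SynthControl

theorem mainTheorem3 (n r : ℕ) (hr : r ≤ n)
    (f : SynthControl.Vec n × SynthControl.Vec r → SynthControl.Vec n)
    (hf : ContDiff ℝ ((4 * n : ℕ) : WithTop ℕ∞) f)
    (hf0 : f (0, 0) = 0)
    (hS : (SynthControl.controllabilityMatrix
      (SynthControl.jacX f) (SynthControl.jacU f)).rank = n)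
    (N : ℝ) (hN : 0 < N) :
    ∃ ε : ℝ, 0 < ε ∧ ∃ α : ℝ, 0 < α ∧
      ∀ xbar F : SynthControl.Vec n, ‖xbar‖ < ε → ‖F‖ < ε →
        -- a feedback stabilizing the linear non-stationary system
        ∃ M : ℝ → SynthControl.Vec n →L[ℝ] SynthControl.Vec r,
          SynthControl.IsStabilizing
            (SynthControl.linP (SynthControl.perturbed f F) α xbar)
            (SynthControl.linQ (SynthControl.perturbed f F) α xbar) M ∧
          -- the unique solution of the auxiliary initial value problem
          ∃ y : ℝ → SynthControl.Vec n,
            SynthControl.IsAuxIVPSolution (SynthControl.perturbed f F) α xbar M y ∧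
            (∀ y' : ℝ → SynthControl.Vec n,
              SynthControl.IsAuxIVPSolution (SynthControl.perturbed f F) α xbar M y' →
                Set.EqOn y' y (Set.Ici 0)) ∧
            -- gives a solution of the boundary value problem in the original variables
            ∃ (x : ℝ → SynthControl.Vec n) (u : ℝ → SynthControl.Vec r),
              SynthControl.IsBVPSolution (SynthControl.perturbed f F) N xbar x u ∧
              ∀ t ∈ Set.Ico (0 : ℝ) 1,
                x t = xbar + (y (SynthControl.newTime α t) +
                  SynthControl.totalShift (SynthControl.perturbed f F) xbar (1 - t)) ∧
                u t = M (SynthControl.newTime α t) (y (SynthControl.newTime α t)) := by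
  rcases Nat.eq_zero_or_pos n with rfl | hn
  · -- in dimension zero all vectors vanish
    obtain rfl : r = 0 := Nat.le_zero.1 hr
    have hconst : ∀ (E : Type) [NormedAddCommGroup E] [NormedSpace ℝ E] [Subsingleton E]
        (h : ℝ → E) (v : E) (s : Set ℝ) (t : ℝ), HasDerivWithinAt h v s t := by
      intro E _ _ _ h v s t
      rw [Subsingleton.elim h fun _ => 0, Subsingleton.elim v 0]
      exact hasDerivWithinAt_const t s 0
    refine ⟨1, one_pos, 1, one_pos, fun xbar F _ _ => ⟨fun _ => 0, ⟨continuousOn_const, fun _ => 0,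
      Subsingleton.elim _ _, fun τ _ => hconst _ _ _ _ _, 1, one_pos, 1, one_pos, fun τ _ => ?_⟩,
      fun _ => 0, ⟨Subsingleton.elim _ _, fun τ _ => hconst _ _ _ _ _⟩,
      fun y' _ τ _ => Subsingleton.elim _ _, fun _ => 0, fun _ => 0,
      ⟨continuousOn_const, continuousOn_const, fun t _ => hconst _ _ _ _ _, fun t _ => ?_,
        Subsingleton.elim _ _, Subsingleton.elim _ _⟩,
      fun t _ => ⟨Subsingleton.elim _ _, Subsingleton.elim _ _⟩⟩⟩
    · rw [norm_zero]
      positivity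
    · rwa [norm_zero]
  · obtain ⟨ε, hε, h⟩ := Metric.eventually_nhds_iff.1
      (SynthControl.eventually_exists_synthesis hn hf hf0 hS hN)
    refine ⟨ε, hε, 1, one_pos, fun xbar F hx hF => h (y := (xbar, F)) ?_⟩
    rw [dist_zero_right, Prod.norm_def]
    exact max_lt hx hF
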